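/- **Notation.** $|\cdot|$ is the Euclidean norm, $\mathbb{R}^+=[0,\infty)$, $\|x\|_r=\sup_{\theta\in[-r,0]}|x(\theta)|$, $(T_r(t)x)(\theta)=x(t+\theta)$ for $\theta\in[-r,0]$. $K^+$: positive continuous functions on $\mathbb{R}^+$. $\rho:\mathbb{R}^+\to\mathbb{R}^+$ is positive definite if $\rho(0)=0$ and $\rho(s)>0$ for $s>0$. $\mathcal N$: non-decreasing functions $\mathbb{R}^+\to\mathbb{R}^+$ vanishing at $0$. $K$: continuous, strictly increasing, positive definite functions; $K_\infty$: functions of class $K$ tending to $+\infty$ at $+\infty$. $KL$: continuous $\sigma:\mathbb{R}^+\times\mathbb{R}^+\to\mathbb{R}^+$ with $\sigma(\cdot,t)\in K$ for each $t$, and $\sigma(s,\cdot)$ non-increasing with limit $0$ at $+\infty$ for each $s$. $L^\infty_{loc}(\mathbb{R}^+;\Omega)$: measurable functions $\mathbb{R}^+\to\Omega$ that are bounded on bounded intervals. **System.** Let $r_1\ge 0$, let $D\subseteq\mathbb{R}^l$ be non-empty, $0\in U\subseteq\mathbb{R}^m$, $0\in S_1\subseteq\mathbb{R}^{k_1}$,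 $0\in S_2\subseteq\mathbb{R}^{k_2}$, write $C=C^0([-r_1,0];\mathbb{R}^{n_1})$, and consider $$\dot x_1(t)=f_1(t,d(t),T_{r_1}(t)x_1,u(t),v_1(t)),\qquad Y_1(t)=H_1(t,T_{r_1}(t)x_1),\qquad t\ge0, \tag{1}$$ with $f_1:\mathbb{R}^+\times D\times C\times U\times S_2\to\mathbb{R}^{n_1}$, $H_1:\mathbb{R}^+\times C\to S_1$, under the hypotheses: * $H_1$ is continuous, maps bounded sets into bounded sets, and $H_1(t,0)=0$ for all $t\ge 0$. * There are $\hat a\in K_\infty$, $\hat\beta\in K^+$ with $|f_1(t,d,x,u,v)|\le \hat a(\hat\beta(t)\|x\|_{r_1})+\hat a(\hat\beta(t)|u|)+\hat a(\hat\beta(t)|v|)$ for all $(t,d,x,u,v)$. * For each fixed $t\ge0$ the map $(x,u,v,d)\mapsto f_1(t,d,x,u,v)$ is continuous; and for all bounded $I\subseteq\mathbb{R}^+$ and bounded $\Omega\subset C\times U\times S_2$ there is $L\ge0$ such that $(x(0)-y(0))'(f_1(t,d,x,u,v)-f_1(t,d,y,u,v))\le L\|x-y\|_{r_1}^2$ for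 all $t\in I$, $(x,u,v),(y,u,v)\in\Omega$, $d\in D$. * There is a set $A\subset\mathbb{R}^+$, either finite or of the form $\{t_k:k\ge1\}$ with $0<t_k<t_{k+1}$ and $t_k\to\infty$, such that $f_1$ is continuous in $(t,d,x,u,v)$ on $(\mathbb{R}^+\setminus A)\times D\times C\times U\times S_2$; and $\lim_{t\to t_0^+}f_1(t,d,x,u,v)=f_1(t_0,d,x,u,v)$ for each fixed $(t_0,d,x,u,v)$. Data are $(t_0,x_{10},(v_1,u,d))\in\mathbb{R}^+\times C\times L^\infty_{loc}(\mathbb{R}^+;S_2\times U\times D)$. A solution on $[t_0,T)$, $t_0<T\le+\infty$, is a continuous $x_1$ on $[t_0-r_1,T)$ with $T_{r_1}(t_0)x_1=x_{10}$, absolutely continuous on $[t_0,c]$ for every $c\in(t_0,T)$, satisfying (1) a.e. on $[t_0,T)$. **Proposition 3.5.** Suppose there exist a locally Lipschitz $V:[-r_1,\infty)\times\mathbb{R}^{n_1}\to\mathbb{R}^+$, functions $a_2,a\in K_\infty$ with $a(s)<s$ for all $s>0$, $\zeta,\zeta^u\in\mathcal N$, $\beta,\delta_1,\delta_1^u\in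 K^+$ and a continuous positive definite $\rho$ such that $$V(t-r_1,x)\le a_2(\beta(t)|x|)\qquad\forall (t,x)\in\mathbb{R}^+\times\mathbb{R}^{n_1},$$ and such that, with $D^+V(t,x;w)=\limsup_{h\to0^+}\frac{V(t+h,x+hw)-V(t,x)}{h}$, $$D^+V(t,x_1(0);f_1(t,d,x_1,u,v_1))\le-\rho(V(t,x_1(0)))$$ for all $(t,x_1,u,v_1,d)\in\mathbb{R}^+\times C\times U\times S_2\times D$ with $$\max\Big\{\zeta(\delta_1(t)|v_1|),\ \zeta^u(\delta_1^u(t)|u|),\ a\Big(\sup_{\theta\in[-r_1,0]}V(t+\theta,x_1(\theta))\Big)\Big\}\le V(t,x_1(0)).$$ For functions $\phi,\mu_1,c_1\in K^+$ and $g_1,p_1,p_1^u\in\mathcal N$ consider the estimate, for $t\ge t_0$, $$\phi(t)\|T_{r_1}(t)x_1\|_{r_1}\le\max\Big\{\mu_1(t-t_0),\,c_1(t_0),\,g_1(\|x_{10}\|_{r_1}),\,\sup_{t_0\le\tau\le t}p_1(|v_1(\tau)|),\,\sup_{t_0\le\tau\le t}p_1^u(\delta_1^u(\tau)|u(\tau)|)\Big\}.\tag{2}$$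 (A) Suppose there is $a_1\in K_\infty$ with $a_1(|H_1(t,x_1)|)\le\sup_{\theta\in[-r_1,0]}V(t+\theta,x_1(\theta))$ for all $(t,x_1)\in\mathbb{R}^+\times C$, and there exist $\mu_1,c_1,\phi\in K^+$, $g_1,p_1,p_1^u\in\mathcal N$ such that for all data the solution of (1) exists for all $t\ge t_0$ and satisfies (2). Then there exists $\sigma_1\in KL$ such that for all data and all $t\ge t_0$ the solution satisfies $$|H_1(t,T_{r_1}(t)x_1)|\le\sigma_1(\beta_1(t_0)\|x_{10}\|_{r_1},t-t_0)+\sup_{t_0\le\tau\le t}\gamma_1(\delta_1(\tau)|v_1(\tau)|)+\sup_{t_0\le\tau\le t}\gamma_1^u(\delta_1^u(\tau)|u(\tau)|),$$ where $\beta_1(t)=\max_{0\le\tau\le t+r_1}\beta(\tau)$, $\gamma_1(s)=a_1^{-1}(\zeta(s))$, $\gamma_1^u(s)=a_1^{-1}(\zeta^u(s))$. (B) Suppose there are $p\in K_\infty$, $\mu\in K^+$ and $R\ge0$ with $p(\mu(t)|x|)\le V(t-r_1,x)+R$ for all $(t,x)\in\mathbb{R}^+\times\mathbb{R}^{n_1}$,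 and $\delta_1\equiv1$. Then for all data the solution of (1) exists for all $t\ge t_0$ (that is, there is a solution on $[t_0,+\infty)$, and every solution on an interval $[t_0,T)$ is a restriction of it). Furthermore, for every $\phi\in K^+$ there exist $\mu_1,c_1\in K^+$, $g_1,p_1,p_1^u\in\mathcal N$ such that (2) holds for all data and all $t\ge t_0$. Moreover, if $\phi$ is bounded and there is $L>0$ with $\beta(t)+\frac1{\mu(t)}\le L$ for all $t\ge0$, then $c_1$ can be taken bounded. -/

import Mathlib

open Set Filter Topology MeasureTheory
open scoped NNReal

noncomputable section

/-- Euclidean space `ℝⁿ` with its Euclidean norm. -/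
abbrev Euc (n : ℕ) : Type := EuclideanSpace ℝ (Fin n)

/-! Comparison functions. A function on `[0, ∞)` is represented by a function on `ℝ`, of which only
the values on `[0, ∞)` matter. -/

/-- Class `K⁺`: positive continuous functions on `[0, ∞)`. -/
def ClassKPlus (β : ℝ → ℝ) : Prop :=
  ContinuousOn β (Ici 0) ∧ ∀ t, 0 ≤ t → 0 < β t

/-- Positive definite functions `[0, ∞) → [0, ∞)`. -/
def PosDefFun (ρ : ℝ → ℝ) : Prop :=
  ρ 0 = 0 ∧ ∀ s, 0 < s → 0 < ρ s

/-- Class `𝒩`: non-decreasing functions `[0, ∞) → [0, ∞)` vanishing at `0`. -/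
def ClassN (ρ : ℝ → ℝ) : Prop :=
  MonotoneOn ρ (Ici 0) ∧ ρ 0 = 0

/-- Class `K`: positive definite, (strictly) increasing, continuous functions. -/
def ClassK (a : ℝ → ℝ) : Prop :=
  PosDefFun a ∧ StrictMonoOn a (Ici 0) ∧ ContinuousOn a (Ici 0)

/-- Class `K_∞`. -/
def ClassKInf (a : ℝ → ℝ) : Prop :=
  ClassK a ∧ Tendsto a atTop atTop

/-- Class `KL`. -/
def ClassKL (σ : ℝ → ℝ → ℝ) : Prop :=
  ContinuousOn (fun p : ℝ × ℝ => σ p.1 p.2) (Ici 0 ×ˢ Ici 0) ∧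
  (∀ t, 0 ≤ t → ClassK fun s => σ s t) ∧
  (∀ s, 0 ≤ s → AntitoneOn (fun t => σ s t) (Ici 0) ∧ Tendsto (fun t => σ s t) atTop (𝓝 0))

/-- The inverse function `a⁻¹ : [0, ∞) → [0, ∞)` of a function `a` of class `K_∞`. -/
def kInv (a : ℝ → ℝ) : ℝ → ℝ := Function.invFunOn a (Ici 0)

/-! Histories. -/

/-- The state space `C⁰([-r, 0]; ℝⁿ)`, with the sup norm of the Euclidean norm. -/
abbrev Hist (r : ℝ≥0) (n : ℕ) : Type := C(Icc (-(r : ℝ)) (0 : ℝ), Euc n)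

/-- The point `0` of `[-r, 0]`. -/
def histZero (r : ℝ≥0) : Icc (-(r : ℝ)) (0 : ℝ) := ⟨0, by simp⟩

open Classical in
/-- The `r`-history `T_r(t)x`, i.e. `θ ↦ x (t + θ)` on `[-r, 0]`, as an element of
`C⁰([-r, 0]; ℝⁿ)`. It is used only when `x` is continuous on `[t - r, t]`. -/
def history (r : ℝ≥0) {n : ℕ} (x : ℝ → Euc n) (t : ℝ) : Hist r n :=
  if h : Continuous (fun θ : Icc (-(r : ℝ)) (0 : ℝ) => x (t + θ)) then ⟨_, h⟩ else 0

/-! The retarded system with inputs `v`, `u`, disturbance `d`, and its output. -/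

/-- The data of the system `ẋ(t) = f(t, d(t), T_r(t)x, u(t), v(t))`, `Y(t) = H(t, T_r(t)x)`, with
`x(t) ∈ ℝⁿ`, `d(t) ∈ D ⊆ ℝˡ`, `u(t) ∈ U ⊆ ℝᵐ`, `v(t) ∈ S₂ ⊆ ℝ^{k₂}`, `Y(t) ∈ S₁ ⊆ ℝ^{k₁}`, `t ≥ 0`.
Only the values of `f` and `H` for `t ≥ 0`, `d ∈ D`, `u ∈ U`, `v ∈ S₂` matter. -/
structure RFDESystem (l m n k₁ k₂ : ℕ) where
  r : ℝ≥0
  D : Set (Euc l)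
  U : Set (Euc m)
  S₁ : Set (Euc k₁)
  S₂ : Set (Euc k₂)
  f : ℝ → Euc l → Hist r n → Euc m → Euc k₂ → Euc n
  H : ℝ → Hist r n → Euc k₁

namespace RFDESystem

variable {l m n k₁ k₂ : ℕ}

/-- The standing hypotheses on the system. -/
structure Standing (S : RFDESystem l m n k₁ k₂) : Prop where
  D_nonempty : S.D.Nonempty
  zero_mem_U : 0 ∈ S.U
  zero_mem_S₁ : 0 ∈ S.S₁
  zero_mem_S₂ : 0 ∈ S.S₂
  /-- The output map takes values in `S₁`, is continuous, vanishes at the zero state and maps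
  bounded sets into bounded sets. -/
  H_mem : ∀ t, 0 ≤ t → ∀ x, S.H t x ∈ S.S₁
  H_cont : ContinuousOn (fun p : ℝ × Hist S.r n => S.H p.1 p.2) (Ici 0 ×ˢ univ)
  H_zero : ∀ t, 0 ≤ t → S.H t 0 = 0
  H_bdd : ∀ B : Set (ℝ × Hist S.r n), B ⊆ Ici 0 ×ˢ univ → Bornology.IsBounded B →
    Bornology.IsBounded ((fun p : ℝ × Hist S.r n => S.H p.1 p.2) '' B)
  /-- Growth bound for the right-hand side. -/
  f_growth : ∃ a β : ℝ → ℝ, ClassKInf a ∧ ClassKPlus β ∧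
    ∀ t, 0 ≤ t → ∀ x : Hist S.r n, ∀ u ∈ S.U, ∀ v ∈ S.S₂, ∀ d ∈ S.D,
      ‖S.f t d x u v‖ ≤ a (β t * ‖x‖) + a (β t * ‖u‖) + a (β t * ‖v‖)
  /-- Continuity in `(x, u, v, d)` for each fixed time. -/
  f_cont : ∀ t, 0 ≤ t →
    ContinuousOn (fun p : Hist S.r n × Euc m × Euc k₂ × Euc l =>
      S.f t p.2.2.2 p.1 p.2.1 p.2.2.1) (univ ×ˢ S.U ×ˢ S.S₂ ×ˢ S.D)
  /-- One-sided Lipschitz condition in the state, on bounded sets. -/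
  f_lip : ∀ (I : Set ℝ) (Ω : Set (Hist S.r n × Euc m × Euc k₂)),
    I ⊆ Ici 0 → Bornology.IsBounded I →
    Ω ⊆ univ ×ˢ S.U ×ˢ S.S₂ → Bornology.IsBounded Ω →
    ∃ L : ℝ, 0 ≤ L ∧ ∀ t ∈ I, ∀ x y u v, (x, u, v) ∈ Ω → (y, u, v) ∈ Ω → ∀ d ∈ S.D,
      inner ℝ (x (histZero S.r) - y (histZero S.r)) (S.f t d x u v - S.f t d y u v)
        ≤ L * ‖x - y‖ ^ 2
  /-- Joint continuity away from a discrete set of times, and continuity from the right in time. -/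
  f_time : (∃ A : Set ℝ, A ⊆ Ici 0 ∧
      (A.Finite ∨ ∃ τ : ℕ → ℝ, StrictMono τ ∧ (∀ k, 0 < τ k) ∧ Tendsto τ atTop atTop ∧
        A = range τ) ∧
      ContinuousOn (fun p : ℝ × Hist S.r n × Euc m × Euc k₂ × Euc l =>
        S.f p.1 p.2.2.2.2 p.2.1 p.2.2.1 p.2.2.2.1)
        ((Ici 0 \ A) ×ˢ univ ×ˢ S.U ×ˢ S.S₂ ×ˢ S.D)) ∧
    ∀ t₀, 0 ≤ t₀ → ∀ x : Hist S.r n, ∀ u ∈ S.U, ∀ v ∈ S.S₂, ∀ d ∈ S.D,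
      Tendsto (fun t => S.f t d x u v) (𝓝[>] t₀) (𝓝 (S.f t₀ d x u v))

end RFDESystem

/-- `w` belongs to `L^∞_loc([0, ∞); Ω)`: (Lebesgue) measurable, bounded on bounded intervals, with
values in `Ω`. -/
def IsInput {k : ℕ} (Ω : Set (Euc k)) (w : ℝ → Euc k) : Prop :=
  (∀ t, 0 ≤ t → w t ∈ Ω) ∧
  AEMeasurable w (volume.restrict (Ici (0 : ℝ))) ∧
  ∀ T : ℝ, ∃ M : ℝ, ∀ t ∈ Icc 0 T, ‖w t‖ ≤ M

namespace RFDESystem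

variable {l m n k₁ k₂ : ℕ}

/-- `x` is a solution on `[t₀, T)`, `T ≤ +∞`, with initial condition `T_r(t₀)x = x₀`, corresponding
to the inputs `v`, `u`, `d`: it is continuous on `[t₀ - r, T)`, absolutely continuous on `[t₀, c]`
for every `c ∈ (t₀, T)`, and satisfies the differential equation a.e. on `[t₀, T)`. -/
structure IsSolution (S : RFDESystem l m n k₁ k₂) (t₀ : ℝ) (T : EReal) (x₀ : Hist S.r n)
    (v : ℝ → Euc k₂) (u : ℝ → Euc m) (d : ℝ → Euc l) (x : ℝ → Euc n) : Prop where
  init : ∀ θ : Icc (-(S.r : ℝ)) (0 : ℝ), x (t₀ + θ) = x₀ θ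
  cont : ContinuousOn x {t : ℝ | t₀ - S.r ≤ t ∧ (t : EReal) < T}
  abs_cont : ∀ c : ℝ, t₀ < c → (c : EReal) < T → AbsolutelyContinuousOnInterval x t₀ c
  ode : ∀ᵐ t : ℝ, t₀ ≤ t → (t : EReal) < T →
    HasDerivAt x (S.f t (d t) (history S.r x t) (u t) (v t)) t

/-- Solution existing for all `t ≥ t₀`. -/
def IsGlobalSolution (S : RFDESystem l m n k₁ k₂) (t₀ : ℝ) (x₀ : Hist S.r n)
    (v : ℝ → Euc k₂) (u : ℝ → Euc m) (d : ℝ → Euc l) (x : ℝ → Euc n) : Prop :=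
  S.IsSolution t₀ ⊤ x₀ v u d x

/-- The data `(t₀, x₀, (v, u, d))` range over
`[0, ∞) × C⁰([-r, 0]; ℝⁿ) × L^∞_loc([0, ∞); S₂ × U × D)`. -/
def Admissible (S : RFDESystem l m n k₁ k₂) (t₀ : ℝ)
    (v : ℝ → Euc k₂) (u : ℝ → Euc m) (d : ℝ → Euc l) : Prop :=
  0 ≤ t₀ ∧ IsInput S.S₂ v ∧ IsInput S.U u ∧ IsInput S.D d

/-- The output estimate
`|H(t, T_r(t)x)| ≤ σ(β(t₀)‖x₀‖, t - t₀) + sup γ(δ(τ)|v(τ)|) + sup γᵘ(δᵘ(τ)|u(τ)|)`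
(suprema over `t₀ ≤ τ ≤ t`), for all `t ≥ t₀`. -/
def OutputEstimate (S : RFDESystem l m n k₁ k₂) (σ : ℝ → ℝ → ℝ) (β γ δ γu δu : ℝ → ℝ)
    (t₀ : ℝ) (x₀ : Hist S.r n) (v : ℝ → Euc k₂) (u : ℝ → Euc m) (x : ℝ → Euc n) : Prop :=
  ∀ t, t₀ ≤ t →
    ‖S.H t (history S.r x t)‖ ≤ σ (β t₀ * ‖x₀‖) (t - t₀)
      + (⨆ τ : Icc t₀ t, γ (δ τ * ‖v τ‖)) + (⨆ τ : Icc t₀ t, γu (δu τ * ‖u τ‖))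

/-- The state estimate
`φ(t)‖T_r(t)x‖ ≤ max {μ(t - t₀), c(t₀), g(‖x₀‖), sup p(|v(τ)|), sup pᵘ(δᵘ(τ)|u(τ)|)}`
(suprema over `t₀ ≤ τ ≤ t`), for all `t ≥ t₀`. -/
def StateEstimate (S : RFDESystem l m n k₁ k₂) (φ μ c g p pu δu : ℝ → ℝ)
    (t₀ : ℝ) (x₀ : Hist S.r n) (v : ℝ → Euc k₂) (u : ℝ → Euc m) (x : ℝ → Euc n) : Prop :=
  ∀ t, t₀ ≤ t →
    φ t * ‖history S.r x t‖ ≤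
      max (μ (t - t₀)) (max (c t₀) (max (g ‖x₀‖)
        (max (⨆ τ : Icc t₀ t, p ‖v τ‖) (⨆ τ : Icc t₀ t, pu (δu τ * ‖u τ‖)))))

end RFDESystem

/-- The upper right Dini derivative
`D⁺V(t, x; w) = limsup_{h → 0⁺} (V(t + h, x + h w) - V(t, x)) / h`, as an extended real. -/
def diniDeriv {n : ℕ} (V : ℝ → Euc n → ℝ) (t : ℝ) (x w : Euc n) : EReal :=
  limsup (fun h : ℝ => (((V (t + h) (x + h • w) - V t x) / h : ℝ) : EReal)) (𝓝[>] 0)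

/-- `sup_{θ ∈ [-r, 0]} V(t + θ, x(θ))`. -/
def supHist (r : ℝ≥0) {n : ℕ} (V : ℝ → Euc n → ℝ) (t : ℝ) (x : Hist r n) : ℝ :=
  ⨆ θ : Icc (-(r : ℝ)) (0 : ℝ), V (t + θ) (x θ)

end

/-! ### Comparison functions -/

/-! Along a solution `x` put `w t = V t (x t)`. As `V` is locally Lipschitz and `x` absolutely
continuous, `w` is absolutely continuous and its derivative is almost everywhere the Dini derivative
of `V` in the direction of the right-hand side (`diniDeriv_eq_deriv`). With `C` a bound for the
input gains on the interval considered, the hypothesis becomes scalar (`RazumikhinDecay`): `w' ≤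
-ρ(w)` wherever `w` is at least `C` and at least `a` of its recent values.

The Razumikhin argument rests on `a s < s`. A maximum of `w` above both the initial values and `C`
would exceed `a` of everything before it, so that `w` could not have climbed there: `w` is bounded
by the larger of its initial supremum and `C`. If `w ≤ M`, then while `w` is above `max (a M) C` it
decreases at a rate bounded away from zero, so it falls below that level in a time depending only on
`M`, and stays there. After one more delay the whole history obeys the new bound and the step is
repeated. The iterates of `a` tend to `0`, and the attraction times do not depend on `w`, so one
`KL` function serves all solutions (`exists_classKL_razumikhin`). Composing it with `a₁⁻¹` and `a₂`
gives the output estimate.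

When `V` dominates the state, the same bound on `w` is an a priori bound on `x`. Global existence
follows from solving a truncated equation whose truncation is never reached. That equation is only
one-sided Lipschitz, so it is solved as the limit of equations with a vanishing time lag, which the
method of steps solves; an energy estimate for `‖y - y'‖²` shows the approximations to be Cauchy
(`RegularRHS.exists_solution`). The same energy estimate gives uniqueness.

The state estimate bounds `φ(t)‖T_r(t)x‖` by a product of a function of `t` and a function of the
data. Products become maxima through `αβ ≤ max (α²) (β²)`, and `t ≤ max (2(t - t₀)) (2t₀)` separates
elapsed from initial time. -/

theorem ClassN.nonneg {ζ : ℝ → ℝ} (h : ClassN ζ) {s : ℝ} (hs : 0 ≤ s) : 0 ≤ ζ s := by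
  have := h.1 (mem_Ici.2 le_rfl) (mem_Ici.2 hs) hs
  rwa [h.2] at this

theorem PosDefFun.nonneg {ρ : ℝ → ℝ} (h : PosDefFun ρ) {s : ℝ} (hs : 0 ≤ s) : 0 ≤ ρ s := by
  rcases hs.eq_or_lt with rfl | hs
  · exact h.1.ge
  · exact (h.2 s hs).le

theorem ClassK.nonneg {a : ℝ → ℝ} (h : ClassK a) {s : ℝ} (hs : 0 ≤ s) : 0 ≤ a s := h.1.nonneg hs

theorem ClassK.le_iff_le {a : ℝ → ℝ} (h : ClassK a) {s t : ℝ} (hs : 0 ≤ s) (ht : 0 ≤ t) :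
    a s ≤ a t ↔ s ≤ t := h.2.1.le_iff_le hs ht

theorem ClassK.lt_iff_lt {a : ℝ → ℝ} (h : ClassK a) {s t : ℝ} (hs : 0 ≤ s) (ht : 0 ≤ t) :
    a s < a t ↔ s < t := h.2.1.lt_iff_lt hs ht

theorem ClassK.mono {a : ℝ → ℝ} (h : ClassK a) {s t : ℝ} (hs : 0 ≤ s) (hst : s ≤ t) :
    a s ≤ a t := (h.le_iff_le hs (hs.trans hst)).2 hst

theorem ClassKInf.exists_eq {a : ℝ → ℝ} (h : ClassKInf a) {y : ℝ} (hy : 0 ≤ y) :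
    ∃ s, 0 ≤ s ∧ a s = y := by
  obtain ⟨b, hb, hb'⟩ := ((h.2.eventually_ge_atTop y).and (eventually_ge_atTop 0)).exists
  have := intermediate_value_Icc hb' (h.1.2.2.mono Icc_subset_Ici_self)
  obtain ⟨s, hs, rfl⟩ := this ⟨by rw [h.1.1.1]; exact hy, hb⟩
  exact ⟨s, hs.1, rfl⟩

theorem ClassKInf.kInv_nonneg {a : ℝ → ℝ} (h : ClassKInf a) {y : ℝ} (hy : 0 ≤ y) :
    0 ≤ kInv a y :=
  Function.invFunOn_mem (s := Ici 0) (f := a) (h.exists_eq hy)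

theorem ClassKInf.apply_kInv {a : ℝ → ℝ} (h : ClassKInf a) {y : ℝ} (hy : 0 ≤ y) :
    a (kInv a y) = y :=
  Function.invFunOn_eq (s := Ici 0) (f := a) (h.exists_eq hy)

theorem ClassKInf.kInv_le_iff {a : ℝ → ℝ} (h : ClassKInf a) {y z : ℝ} (hy : 0 ≤ y) (hz : 0 ≤ z) :
    kInv a y ≤ z ↔ y ≤ a z := by
  rw [← h.1.le_iff_le (h.kInv_nonneg hy) hz, h.apply_kInv hy]

theorem ClassKInf.le_kInv_iff {a : ℝ → ℝ} (h : ClassKInf a) {y z : ℝ} (hy : 0 ≤ y) (hz : 0 ≤ z) :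
    z ≤ kInv a y ↔ a z ≤ y := by
  rw [← h.1.le_iff_le hz (h.kInv_nonneg hy), h.apply_kInv hy]

/-- Continuity needs only the order: the equivalences `kInv a y ≤ z ↔ y ≤ a z` and `z ≤ kInv a y ↔ a
z ≤ y` turn order neighbourhoods of a value into order neighbourhoods of the argument. -/
theorem ClassKInf.classK_kInv {a : ℝ → ℝ} (h : ClassKInf a) : ClassK (kInv a) := by
  refine ⟨⟨?_, fun s hs => ?_⟩, fun s hs t ht hst => ?_, fun y hy => ?_⟩
  · exact le_antisymm ((h.kInv_le_iff le_rfl le_rfl).2 h.1.1.1.ge) (h.kInv_nonneg le_rfl)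
  · rw [← not_le, h.kInv_le_iff hs.le le_rfl, h.1.1.1]
    exact not_le.2 hs
  · rw [← h.1.lt_iff_lt (h.kInv_nonneg hs) (h.kInv_nonneg ht), h.apply_kInv hs, h.apply_kInv ht]
    exact hst
  · have hy : 0 ≤ y := hy
    refine tendsto_order.2 ⟨fun z hz => ?_, fun z hz => ?_⟩
    · rcases lt_or_ge z 0 with hz0 | hz0
      · filter_upwards [self_mem_nhdsWithin] with s hs using hz0.trans_le (h.kInv_nonneg hs)
      · have : a z < y := by
          rw [← not_le, h.kInv_le_iff hy hz0] at hz; exact not_le.1 hz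
        filter_upwards [self_mem_nhdsWithin, nhdsWithin_le_nhds (lt_mem_nhds this)] with s hs hs'
        rw [← not_le, h.kInv_le_iff hs hz0]; exact not_le.2 hs'
    · have hz0 : 0 ≤ z := (h.kInv_nonneg hy).trans hz.le
      have : y < a z := by
        rw [gt_iff_lt, ← not_le, h.le_kInv_iff hy hz0] at hz; exact not_le.1 hz
      filter_upwards [self_mem_nhdsWithin, nhdsWithin_le_nhds (gt_mem_nhds this)] with s hs hs'
      rw [← not_le, h.le_kInv_iff hs hz0]; exact not_le.2 hs'

theorem ClassK.comp {a b : ℝ → ℝ} (ha : ClassK a) (hb : ClassK b) : ClassK fun s => a (b s) :=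
  ⟨⟨by simp [hb.1.1, ha.1.1], fun s hs => ha.1.2 _ (hb.1.2 s hs)⟩,
    fun _ hs _ ht hst => ha.2.1 (hb.nonneg hs) (hb.nonneg ht) (hb.2.1 hs ht hst),
    ha.2.2.comp hb.2.2 fun _ hs => hb.nonneg hs⟩

theorem ClassKL.nonneg {σ : ℝ → ℝ → ℝ} (h : ClassKL σ) {s t : ℝ} (hs : 0 ≤ s) (ht : 0 ≤ t) :
    0 ≤ σ s t := (h.2.1 t ht).nonneg hs

theorem ClassKL.comp {σ : ℝ → ℝ → ℝ} {a b : ℝ → ℝ} (hσ : ClassKL σ) (ha : ClassK a)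
    (hb : ClassK b) : ClassKL fun s t => a (σ (b s) t) := by
  refine ⟨?_, fun t ht => ha.comp ((hσ.2.1 t ht).comp hb), fun s hs => ⟨?_, ?_⟩⟩
  · have h1 : ContinuousOn (fun p : ℝ × ℝ => (b p.1, p.2)) (Ici 0 ×ˢ Ici 0) :=
      (hb.2.2.comp continuousOn_fst fun p hp => hp.1).prodMk continuousOn_snd
    exact ha.2.2.comp (hσ.1.comp h1 fun p hp => ⟨hb.nonneg hp.1, hp.2⟩)
      fun p hp => hσ.nonneg (hb.nonneg hp.1) hp.2
  · intro t ht t' ht' htt'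
    exact ha.mono (hσ.nonneg (hb.nonneg hs) ht') ((hσ.2.2 _ (hb.nonneg hs)).1 ht ht' htt')
  · have h0 : Tendsto a (𝓝[Ici 0] 0) (𝓝 0) := by
      have := ha.2.2 0 (mem_Ici.2 le_rfl)
      rwa [ContinuousWithinAt, ha.1.1] at this
    refine h0.comp (tendsto_nhdsWithin_iff.2 ⟨(hσ.2.2 _ (hb.nonneg hs)).2, ?_⟩)
    filter_upwards [eventually_ge_atTop 0] with t ht using hσ.nonneg (hb.nonneg hs) ht

/-- A family of triples `(s, t, y)` (size of the initial state, elapsed time, value) that is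
dominated by `s` and uniformly attracted to `0` is dominated by a function of class `KL`. -/
theorem exists_classKL_of_uniform_attraction (E : Set (ℝ × ℝ × ℝ))
    (hE : ∀ e ∈ E, 0 ≤ e.1 ∧ 0 ≤ e.2.1 ∧ e.2.2 ≤ e.1)
    (hatt : ∀ M ε : ℝ, 0 < ε → ∃ τ : ℝ, ∀ e ∈ E, e.1 ≤ M → τ ≤ e.2.1 → e.2.2 ≤ ε) :
    ∃ σ : ℝ → ℝ → ℝ, ClassKL σ ∧ ∀ e ∈ E, e.2.2 ≤ σ e.1 e.2.1 := by
  -- Each triple contributes a Lipschitz bump that takes its value `y` at its own point and is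
  -- penalised for exceeding `s` and for preceding `t`. The constants do not depend on the triple,
  -- so the supremum is continuous. It is nondecreasing in `s`, nonincreasing in `t`, and at most
  -- `s` since `y ≤ e.1`. The factor `2` makes the bump nonpositive once `e.1 ≥ 2 * s`.
  let g : E → ℝ × ℝ → ℝ := fun e p => e.1.2.2 - 2 * max (e.1.1 - p.1) 0 - max (p.2 - e.1.2.1) 0
  have hg_le : ∀ e p, g e p ≤ p.1 := by
    intro e p
    have h := hE e.1 e.2
    have h1 := le_max_left (e.1.1 - p.1) 0
    have h2 := le_max_right (e.1.1 - p.1) 0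
    have h3 := le_max_right (p.2 - e.1.2.1) 0
    simp only [g]; linarith
  have hbdd : ∀ p, BddAbove (range fun e => g e p) := fun p =>
    ⟨p.1, by rintro _ ⟨e, rfl⟩; exact hg_le e p⟩
  let σ₀ : ℝ × ℝ → ℝ := fun p => max 0 (⨆ e, g e p)
  have hcont : Continuous fun p => ⨆ e, g e p := by
    refine (LipschitzWith.of_le_add_mul 3 (f := fun p => ⨆ e, g e p) fun p q => ?_).continuous
    rcases isEmpty_or_nonempty E with hem | hne
    · simp only [Real.iSup_of_isEmpty]; positivity
    · refine ciSup_le fun e => ?_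
      have h1 : g e q ≤ ⨆ e, g e q := le_ciSup (hbdd q) e
      have h2 : |p.1 - q.1| ≤ dist p q := by rw [Prod.dist_eq, ← Real.dist_eq]; exact le_max_left _ _
      have h3 : |p.2 - q.2| ≤ dist p q := by rw [Prod.dist_eq, ← Real.dist_eq]; exact le_max_right _ _
      have h4 : max (e.1.1 - q.1) 0 ≤ max (e.1.1 - p.1) 0 + |p.1 - q.1| := by
        refine max_le ?_ (by positivity)
        have := le_max_left (e.1.1 - p.1) 0
        have := le_abs_self (p.1 - q.1)
        linarith
      have h5 : max (q.2 - e.1.2.1) 0 ≤ max (p.2 - e.1.2.1) 0 + |p.2 - q.2| := by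
        refine max_le ?_ (by positivity)
        have := le_max_left (p.2 - e.1.2.1) 0
        have := neg_abs_le (p.2 - q.2)
        linarith
      have h6 : g e p ≤ g e q + 3 * dist p q := by simp only [g]; linarith
      simp only [NNReal.coe_ofNat]
      linarith
  have hσ_le : ∀ s t, 0 ≤ s → σ₀ (s, t) ≤ s := fun s t hs =>
    max_le hs (Real.iSup_le (fun e => hg_le e (s, t)) hs)
  have hσ_nonneg : ∀ p, 0 ≤ σ₀ p := fun p => le_max_left _ _
  have hmono : ∀ p q : ℝ × ℝ, p.1 ≤ q.1 → q.2 ≤ p.2 → σ₀ p ≤ σ₀ q := by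
    intro p q h1 h2
    refine max_le_max le_rfl (ciSup_mono (hbdd q) fun e => ?_)
    have h4 : max (e.1.1 - q.1) 0 ≤ max (e.1.1 - p.1) 0 := max_le_max (by linarith) le_rfl
    have h5 : max (q.2 - e.1.2.1) 0 ≤ max (p.2 - e.1.2.1) 0 := max_le_max (by linarith) le_rfl
    simp only [g]; linarith
  have htend : ∀ s, 0 ≤ s → Tendsto (fun t => σ₀ (s, t)) atTop (𝓝 0) := by
    intro s hs
    refine tendsto_order.2 ⟨fun z hz => Eventually.of_forall fun t => hz.trans_le (hσ_nonneg _),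
      fun z hz => ?_⟩
    -- Triples with `e.1 > 2 * s` contribute nothing positive. Among the others, late ones satisfy
    -- `y ≤ z / 2` by attraction, and those earlier than `τ` pay a time penalty of at least `2 * s ≥
    -- y`.
    obtain ⟨τ, hτ⟩ := hatt (2 * s) (z / 2) (by linarith)
    filter_upwards [eventually_ge_atTop (τ + 2 * s)] with t ht
    refine lt_of_le_of_lt (b := z / 2) (max_le (by linarith) (Real.iSup_le (fun e => ?_)
      (by linarith))) (by linarith)
    have h := hE e.1 e.2
    have h1 := le_max_left (e.1.1 - s) 0
    have h2 := le_max_right (e.1.1 - s) 0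
    have h3 := le_max_right (t - e.1.2.1) 0
    have h4 := le_max_left (t - e.1.2.1) 0
    simp only [g]
    by_cases h5 : e.1.1 ≤ 2 * s
    · by_cases h6 : τ ≤ e.1.2.1
      · have := hτ e.1 e.2 h5 h6
        linarith
      · linarith
    · linarith
  -- The added term `s * exp (-t)` supplies strict monotonicity and positivity in `s`.
  refine ⟨fun s t => σ₀ (s, t) + s * Real.exp (-t), ⟨?_, fun t ht => ⟨⟨?_, fun s hs => ?_⟩,
    fun s hs s' hs' hss' => ?_, ?_⟩, fun s hs => ⟨fun t ht t' ht' htt' => ?_, ?_⟩⟩,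
    fun e he => ?_⟩
  · exact Continuous.continuousOn (by
      have : Continuous σ₀ := continuous_const.max hcont
      fun_prop)
  · have : σ₀ (0, t) = 0 := le_antisymm (hσ_le 0 t le_rfl) (hσ_nonneg _)
    simp [this]
  · have := hσ_nonneg (s, t)
    have := mul_pos hs (Real.exp_pos (-t))
    show 0 < σ₀ (s, t) + s * Real.exp (-t)
    linarith
  · have h1 := hmono (s, t) (s', t) hss'.le le_rfl
    have h2 := mul_lt_mul_of_pos_right hss' (Real.exp_pos (-t))
    show σ₀ (s, t) + s * Real.exp (-t) < σ₀ (s', t) + s' * Real.exp (-t)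
    linarith
  · exact Continuous.continuousOn (by
      have : Continuous σ₀ := continuous_const.max hcont
      fun_prop)
  · have h1 := hmono (s, t') (s, t) le_rfl htt'
    have h2 := mul_le_mul_of_nonneg_left (Real.exp_le_exp.2 (neg_le_neg htt')) hs
    show σ₀ (s, t') + s * Real.exp (-t') ≤ σ₀ (s, t) + s * Real.exp (-t)
    linarith
  · have h1 : Tendsto (fun t : ℝ => s * Real.exp (-t)) atTop (𝓝 (s * 0)) :=
      (Real.tendsto_exp_neg_atTop_nhds_zero).const_mul s
    simpa using (htend s hs).add h1
  · have h := hE e he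
    have h1 : g ⟨e, he⟩ (e.1, e.2.1) ≤ σ₀ (e.1, e.2.1) :=
      (le_ciSup (hbdd _) (⟨e, he⟩ : E)).trans (le_max_right _ _)
    have h2 : g ⟨e, he⟩ (e.1, e.2.1) = e.2.2 := by simp [g]
    have h3 := mul_nonneg h.1 (Real.exp_pos (-e.2.1)).le
    show e.2.2 ≤ σ₀ (e.1, e.2.1) + e.1 * Real.exp (-e.2.1)
    linarith

/-! ### Differential inequalities for absolutely continuous functions -/

theorem AbsolutelyContinuousOnInterval.sub_le_of_ae_deriv_le {w : ℝ → ℝ} {a b c : ℝ} (hab : a ≤ b)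
    (hw : AbsolutelyContinuousOnInterval w a b)
    (h : ∀ᵐ t, t ∈ Ioo a b → deriv w t ≤ c) : w b - w a ≤ c * (b - a) := by
  rw [← hw.integral_deriv_eq_sub]
  have : ∫ _ in a..b, c = c * (b - a) := by simp [mul_comm]
  rw [← this]
  refine intervalIntegral.integral_mono_ae_restrict hab hw.intervalIntegrable_deriv (by simp) ?_
  rw [EventuallyLE, ae_restrict_iff' measurableSet_Icc]
  filter_upwards [h, (by simp [ae_iff, measure_singleton] : ∀ᵐ x : ℝ, x ≠ a),
    (by simp [ae_iff, measure_singleton] : ∀ᵐ x : ℝ, x ≠ b)] with t ht h1 h2 h3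
  exact ht ⟨lt_of_le_of_ne h3.1 h1.symm, lt_of_le_of_ne h3.2 h2⟩

theorem AbsolutelyContinuousOnInterval.mono_Icc {X : Type*} [PseudoMetricSpace X] {w : ℝ → X}
    {a b c d : ℝ} (hw : AbsolutelyContinuousOnInterval w a b) (hac : a ≤ c) (hcd : c ≤ d)
    (hdb : d ≤ b) : AbsolutelyContinuousOnInterval w c d :=
  hw.mono (by
    rw [uIcc_of_le hcd, uIcc_of_le (hac.trans (hcd.trans hdb))]
    exact Icc_subset_Icc hac hdb)

/-- If `q` is continuous on `[t₀, T]`, and exceeds `b` somewhere on it although `q t₀ ≤ b`, then it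
exceeds `b` on a left-open interval whose left end point has value at most `b`. -/
theorem exists_last_le {q : ℝ → ℝ} {t₀ T b : ℝ} (hT : t₀ ≤ T) (hq : ContinuousOn q (Icc t₀ T))
    (h0 : q t₀ ≤ b) : ∃ t₁ ∈ Icc t₀ T, q t₁ ≤ b ∧ ∀ t ∈ Ioc t₁ T, b < q t := by
  have hcl : IsClosed (Icc t₀ T ∩ q ⁻¹' Iic b) := hq.preimage_isClosed_of_isClosed isClosed_Icc isClosed_Iic
  have hcpt : IsCompact (Icc t₀ T ∩ q ⁻¹' Iic b) :=
    isCompact_Icc.of_isClosed_subset hcl inter_subset_left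
  obtain ⟨t₁, ht₁⟩ := hcpt.exists_isGreatest ⟨t₀, ⟨le_rfl, hT⟩, h0⟩
  refine ⟨t₁, ht₁.1.1, ht₁.1.2, fun t ht => ?_⟩
  by_contra hcon
  exact absurd (ht₁.2 ⟨⟨ht₁.1.1.1.trans ht.1.le, ht.2⟩, not_lt.1 hcon⟩) (not_le.2 ht.1)

/-- A Gronwall inequality with running maximum. -/
theorem AbsolutelyContinuousOnInterval.le_mul_exp {q : ℝ → ℝ} {t₀ T K ε : ℝ} (hK : 0 ≤ K)
    (hε : 0 < ε) (hT : t₀ ≤ T) (hq : AbsolutelyContinuousOnInterval q t₀ T) (h0 : q t₀ ≤ 0)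
    (h : ∀ᵐ t, t ∈ Ioo t₀ T → ∀ b, 0 ≤ b → (∀ s ∈ Icc t₀ t, q s ≤ b) → deriv q t ≤ K * b + ε) :
    ∀ t ∈ Icc t₀ T, q t ≤ ε * Real.exp ((K + 1) * (t - t₀)) := by
  -- Barrier: `p ≥ ε` gives `p' = (K + 1) * p ≥ K * p + ε`, and `p` is increasing, so `p t` is an
  -- admissible running bound up to the first contact. There `q - p` would have risen from a
  -- negative value to `0` with nonpositive derivative.
  let p : ℝ → ℝ := fun t => ε * Real.exp ((K + 1) * (t - t₀))
  have hp : ∀ t, HasDerivAt p ((K + 1) * p t) t := by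
    intro t
    have h1 : HasDerivAt (fun t => (K + 1) * (t - t₀)) ((K + 1) * 1) t :=
      ((hasDerivAt_id t).sub_const t₀).const_mul _
    have := (h1.exp).const_mul ε
    exact this.congr_deriv (by simp only [p]; ring)
  have hp_mono : Monotone p := by
    intro s t hst
    simp only [p]
    gcongr
  have hpε : ∀ t, t₀ ≤ t → ε ≤ p t := by
    intro t ht
    simp only [p]
    have : (1 : ℝ) ≤ Real.exp ((K + 1) * (t - t₀)) :=
      Real.one_le_exp (mul_nonneg (by linarith) (by linarith))
    nlinarith
  have hpc : Continuous p := by simp only [p]; fun_prop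
  have hqc : ContinuousOn q (Icc t₀ T) := by have := hq.continuousOn; rwa [uIcc_of_le hT] at this
  have hpac : ∀ a b, AbsolutelyContinuousOnInterval p a b := fun a b =>
    ContDiffOn.absolutelyContinuousOnInterval (ContDiff.contDiffOn (by simp only [p]; fun_prop))
  by_contra! hcon
  obtain ⟨t₂, ht₂, hlt⟩ := hcon
  -- the first time at which `p ≤ q`
  have hcl : IsClosed (Icc t₀ T ∩ (fun t => q t - p t) ⁻¹' Ici 0) :=
    (hqc.sub hpc.continuousOn).preimage_isClosed_of_isClosed isClosed_Icc isClosed_Ici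
  obtain ⟨t₁, ht₁⟩ := (isCompact_Icc.of_isClosed_subset hcl inter_subset_left).exists_isLeast
    ⟨t₂, ht₂, by simp only [mem_preimage, mem_Ici]; linarith [show p t₂ < q t₂ from hlt]⟩
  have hbefore : ∀ s ∈ Ico t₀ t₁, q s ≤ p s := by
    intro s hs
    by_contra hc
    exact absurd (ht₁.2 ⟨⟨hs.1, hs.2.le.trans ht₁.1.1.2⟩, by
      simp only [mem_preimage, mem_Ici]; linarith⟩) (not_le.2 hs.2)
  have hac : AbsolutelyContinuousOnInterval (q - p) t₀ t₁ :=
    (hq.mono_Icc le_rfl ht₁.1.1.1 ht₁.1.1.2).sub (hpac _ _)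
  have hd : ∀ᵐ t, t ∈ Ioo t₀ t₁ → deriv (q - p) t ≤ 0 := by
    filter_upwards [h, hq.ae_differentiableAt] with t h1 h2 ht
    have htT : t ∈ Ioo t₀ T := ⟨ht.1, ht.2.trans_le ht₁.1.1.2⟩
    have hpt := hpε t ht.1.le
    have h3 := h1 htT (p t) (hε.le.trans hpt)
      fun s hs => (hbefore s ⟨hs.1, hs.2.trans_lt ht.2⟩).trans (hp_mono hs.2)
    have h4 := h2 (by rw [uIcc_of_le hT]; exact ⟨htT.1.le, htT.2.le⟩)
    have h5 : deriv (q - p) t = deriv q t - (K + 1) * p t := (h4.hasDerivAt.sub (hp t)).deriv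
    rw [h5]
    linarith
  have : (q t₁ - p t₁) - (q t₀ - p t₀) ≤ 0 * (t₁ - t₀) := hac.sub_le_of_ae_deriv_le ht₁.1.1.1 hd
  have h6 : 0 ≤ q t₁ - p t₁ := ht₁.1.2
  have h7 := hpε t₀ le_rfl
  linarith

/-! ### The Razumikhin decay condition for a scalar function -/

/-- `w` is a nonnegative function on `[t₀ - r, T]` that decreases at rate `ρ(w)` at almost all times
at which it is above the level `C` and above `a` of its own recent values. -/
structure RazumikhinDecay (r : ℝ) (a ρ w : ℝ → ℝ) (t₀ T C : ℝ) : Prop where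
  le : t₀ ≤ T
  level_nonneg : 0 ≤ C
  cont : ContinuousOn w (Icc (t₀ - r) T)
  nonneg : ∀ s ∈ Icc (t₀ - r) T, 0 ≤ w s
  ac : AbsolutelyContinuousOnInterval w t₀ T
  decr : ∀ᵐ t, t ∈ Ioo t₀ T → C ≤ w t → (∀ s ∈ Icc (t - r) t, a (w s) ≤ w t) →
    deriv w t ≤ -ρ (w t)

namespace RazumikhinDecay

variable {r : ℝ} {a ρ w : ℝ → ℝ} {t₀ T C : ℝ}

theorem restrict (h : RazumikhinDecay r a ρ w t₀ T C) {t₁ T₁ : ℝ} (h0 : t₀ ≤ t₁) (h1 : t₁ ≤ T₁)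
    (hT : T₁ ≤ T) : RazumikhinDecay r a ρ w t₁ T₁ C where
  le := h1
  level_nonneg := h.level_nonneg
  cont := h.cont.mono (Icc_subset_Icc (by linarith) hT)
  nonneg := fun s hs => h.nonneg s ⟨by linarith [hs.1], hs.2.trans hT⟩
  ac := h.ac.mono_Icc h0 h1 hT
  decr := by
    filter_upwards [h.decr] with t ht htt
    exact ht ⟨h0.trans_lt htt.1, htt.2.trans_le hT⟩

/-- Sublevel sets above the input level and above `a` of the overall maximum are invariant. -/
theorem le_of_le (h : RazumikhinDecay r a ρ w t₀ T C) (hr : 0 ≤ r) (ha : ClassK a)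
    (hρ : PosDefFun ρ) {M b : ℝ} (hM : ∀ s ∈ Icc (t₀ - r) T, w s ≤ M) (hab : a M ≤ b) (hCb : C ≤ b)
    (h0 : w t₀ ≤ b) : w T ≤ b := by
  obtain ⟨t₁, ht₁, hle, hgt⟩ := exists_last_le h.le
    (h.cont.mono (Icc_subset_Icc (by linarith) le_rfl)) h0
  have hac := h.ac.mono_Icc ht₁.1 ht₁.2 le_rfl
  have := hac.sub_le_of_ae_deriv_le (c := 0) ht₁.2 (by
    filter_upwards [h.decr] with t ht htt
    have hlt := hgt t ⟨htt.1, htt.2.le⟩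
    have htI : t ∈ Ioo t₀ T := ⟨ht₁.1.trans_lt htt.1, htt.2⟩
    refine (ht htI (hCb.trans hlt.le) fun s hs => ?_).trans ?_
    · have hs' : s ∈ Icc (t₀ - r) T := ⟨by linarith [hs.1, htI.1], hs.2.trans htI.2.le⟩
      exact (ha.mono (h.nonneg s hs') (hM s hs')).trans (hab.trans hlt.le)
    · have := hρ.nonneg (h.nonneg t ⟨by linarith [htI.1], htI.2.le⟩)
      linarith)
  linarith

/-- If the maximum `w m` exceeded both `M` and `C`, then `a (w m) < w m` would leave a level `b < w
m` above `M`, `C` and `a (w m)`. By `le_of_le` the sublevel set of `b` cannot be left, a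
contradiction. -/
theorem le_max (h : RazumikhinDecay r a ρ w t₀ T C) (hr : 0 ≤ r) (ha : ClassK a)
    (ha_lt : ∀ s, 0 < s → a s < s) (hρ : PosDefFun ρ) {M : ℝ}
    (hM : ∀ s ∈ Icc (t₀ - r) t₀, w s ≤ M) : ∀ s ∈ Icc (t₀ - r) T, w s ≤ max M C := by
  have hle := h.le
  obtain ⟨m, hm, hmax⟩ := isCompact_Icc.exists_isMaxOn (s := Icc (t₀ - r) T)
    ⟨T, by linarith, le_rfl⟩ h.cont
  by_contra! hcon
  obtain ⟨s, hs, hlt⟩ := hcon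
  have hlt : max M C < w m := hlt.trans_le (hmax hs)
  have hpos : 0 < w m := (h.level_nonneg.trans (le_max_right _ _)).trans_lt hlt
  have hb : max (max M C) (a (w m)) < w m := max_lt hlt (ha_lt _ hpos)
  have : w m ≤ max (max M C) (a (w m)) := by
    rcases le_total m t₀ with h1 | h1
    · exact (hM m ⟨hm.1, h1⟩).trans ((le_max_left _ _).trans (le_max_left _ _))
    · exact (h.restrict le_rfl h1 hm.2).le_of_le hr ha hρ (M := w m)
        (fun s hs => hmax ⟨hs.1, hs.2.trans hm.2⟩) (le_max_right _ _)
        ((le_max_right _ _).trans (le_max_left _ _))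
        ((hM t₀ ⟨by linarith, le_rfl⟩).trans ((le_max_left _ _).trans (le_max_left _ _)))
  linarith

/-- Once `w` reaches the target level it stays below it. Otherwise it decreases at rate at least `c`
for a time at least `M / c`, which would bring it from at most `M` down to `0 < a M`. -/
theorem le_max_of_decay (h : RazumikhinDecay r a ρ w t₀ T C) (hr : 0 ≤ r) (ha : ClassK a)
    (hρ : PosDefFun ρ) {M c : ℝ} (hM0 : 0 < M) (hM : ∀ s ∈ Icc (t₀ - r) T, w s ≤ M) (hc : 0 < c)
    (hcρ : ∀ s ∈ Icc (a M) M, c ≤ ρ s) (hT : t₀ + M / c ≤ T) : w T ≤ max (a M) C := by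
  by_cases hex : ∃ t ∈ Icc t₀ T, w t ≤ max (a M) C
  · obtain ⟨t, ht, hle⟩ := hex
    exact (h.restrict ht.1 ht.2 le_rfl).le_of_le hr ha hρ
      (fun s hs => hM s ⟨by linarith [hs.1, ht.1], hs.2⟩) (le_max_left _ _) (le_max_right _ _) hle
  · push Not at hex
    exfalso
    have := h.ac.sub_le_of_ae_deriv_le (c := -c) h.le (by
      filter_upwards [h.decr] with t ht htt
      have hlt := hex t ⟨htt.1.le, htt.2.le⟩
      have htI : t ∈ Icc (t₀ - r) T := ⟨by linarith [htt.1], htt.2.le⟩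
      refine (ht htt ((le_max_right _ _).trans hlt.le) fun s hs => ?_).trans ?_
      · have hs' : s ∈ Icc (t₀ - r) T := ⟨by linarith [hs.1, htt.1], hs.2.trans htt.2.le⟩
        exact (ha.mono (h.nonneg s hs') (hM s hs')).trans ((le_max_left _ _).trans hlt.le)
      · exact neg_le_neg (hcρ _ ⟨(le_max_left _ _).trans hlt.le, hM t htI⟩))
    have h1 : M ≤ c * (T - t₀) := by
      have : M / c ≤ T - t₀ := by linarith
      rw [div_le_iff₀ hc] at this
      linarith
    have h2 := hM t₀ ⟨by linarith, h.le⟩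
    have h3 := hex T ⟨h.le, le_rfl⟩
    have h4 := ha.1.2 M hM0
    have h5 := le_max_left (a M) C
    linarith

end RazumikhinDecay

/-- Uniform attraction, to the `k`-th iterate of `a`. -/
theorem exists_time_le_iterate {r : ℝ} {a ρ : ℝ → ℝ} (hr : 0 ≤ r) (ha : ClassK a)
    (ha_lt : ∀ s, 0 < s → a s < s) (hρ : PosDefFun ρ) (hρc : ContinuousOn ρ (Ici 0)) (k : ℕ) :
    ∀ M, 0 < M → ∃ τ, 0 ≤ τ ∧ ∀ w t₀ T C, RazumikhinDecay r a ρ w t₀ T C →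
      (∀ s ∈ Icc (t₀ - r) T, w s ≤ M) → t₀ + τ ≤ T → w T ≤ max (a^[k] M) C := by
  induction k with
  | zero =>
    intro M _
    refine ⟨0, le_rfl, fun w t₀ T C h hM _ => ?_⟩
    exact (hM T ⟨by linarith [h.le], le_rfl⟩).trans (le_max_left _ _)
  | succ k ih =>
    intro M hM0
    have haM : 0 < a M := ha.1.2 M hM0
    obtain ⟨τ, hτ0, hτ⟩ := ih (a M) haM
    obtain ⟨m, hm, hmin⟩ := isCompact_Icc.exists_isMinOn (s := Icc (a M) M)
      ⟨M, (ha_lt M hM0).le, le_rfl⟩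
      (hρc.mono fun x hx => haM.le.trans hx.1)
    have hc : 0 < ρ m := hρ.2 m (haM.trans_le hm.1)
    have hMc : 0 ≤ M / ρ m := by positivity
    -- Time to fall below `a M`, then one delay so that the whole history is below it, then the time
    -- from the induction hypothesis.
    refine ⟨M / ρ m + r + τ, by positivity, fun w t₀ T C h hM hT => ?_⟩
    have hstep : ∀ t ∈ Icc (t₀ + M / ρ m) T, w t ≤ max (a M) C := fun t ht =>
      (h.restrict le_rfl (by linarith [ht.1]) ht.2).le_max_of_decay hr ha hρ hM0
        (fun s hs => hM s ⟨hs.1, hs.2.trans ht.2⟩) hc (fun s hs => hmin hs) ht.1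
    rcases le_total (a M) C with hC | hC
    · have := hstep T ⟨by linarith, le_rfl⟩
      rw [max_eq_right hC] at this
      exact this.trans (le_max_right _ _)
    · rw [max_eq_left hC] at hstep
      exact hτ w (t₀ + M / ρ m + r) T C
        (h.restrict (by linarith) (by linarith) le_rfl)
        (fun s hs => hstep s ⟨by linarith [hs.1], hs.2⟩) (by linarith)

/-- Iterates bounded below by `ε` would decrease to a positive fixed point of the continuous
function `a`, contrary to `a s < s`. -/
theorem exists_iterate_le {a : ℝ → ℝ} (ha : ClassK a) (ha_lt : ∀ s, 0 < s → a s < s) {M ε : ℝ}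
    (hε : 0 < ε) : ∃ k, a^[k] M ≤ ε := by
  by_contra! hcon
  have hanti : Antitone fun k => a^[k] M := antitone_nat_of_succ_le fun k => by
    rw [Function.iterate_succ_apply']
    exact (ha_lt _ (hε.trans (hcon k))).le
  have hlim := tendsto_atTop_ciInf hanti ⟨ε, by rintro _ ⟨k, rfl⟩; exact (hcon k).le⟩
  set l := ⨅ k, a^[k] M
  have hl : ε ≤ l := le_ciInf fun k => (hcon k).le
  have hl0 : 0 < l := hε.trans_le hl
  have hfix := isFixedPt_of_tendsto_iterate hlim (ha.2.2.continuousAt (Ici_mem_nhds hl0))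
  exact (ha_lt l hl0).ne hfix

/-- Razumikhin's estimate: the decay condition forces a `KL` bound, uniformly in `w`. -/
theorem exists_classKL_razumikhin {r : ℝ} {a ρ : ℝ → ℝ} (hr : 0 ≤ r) (ha : ClassK a)
    (ha_lt : ∀ s, 0 < s → a s < s) (hρ : PosDefFun ρ) (hρc : ContinuousOn ρ (Ici 0)) :
    ∃ σ, ClassKL σ ∧ ∀ w t₀ T C M, RazumikhinDecay r a ρ w t₀ T C →
      (∀ s ∈ Icc (t₀ - r) t₀, w s ≤ M) →
      ∀ s ∈ Icc (T - r) T, w s ≤ max (σ M (T - t₀)) C := by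
  -- Only values above the level `C` are collected, so that the attraction is to `0` and does not
  -- involve `C`. The time `t` ranges over the whole window `[T - r, T]`, so the bound covers the
  -- history at `T` at once.
  obtain ⟨σ, hσ, hle⟩ := exists_classKL_of_uniform_attraction
    {e | 0 ≤ e.1 ∧ 0 ≤ e.2.1 ∧ e.2.2 ≤ e.1 ∧ ∃ w t₀ T C t, RazumikhinDecay r a ρ w t₀ T C ∧
      (∀ s ∈ Icc (t₀ - r) t₀, w s ≤ e.1) ∧ t ∈ Icc (T - r) T ∧ T - t₀ = e.2.1 ∧ w t = e.2.2 ∧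
      C < w t} (fun e he => ⟨he.1, he.2.1, he.2.2.1⟩) (by
      intro M ε hε
      -- The maximum with `1` provides the positive bound that the attraction lemma requires.
      obtain ⟨k, hk⟩ := exists_iterate_le (M := max M 1) ha ha_lt hε
      obtain ⟨τ, hτ0, hτ⟩ := exists_time_le_iterate hr ha ha_lt hρ hρc k (max M 1)
        (lt_max_of_lt_right one_pos)
      -- The extra `r` compensates for `t` lying up to `r` before `T`.
      refine ⟨τ + r, ?_⟩
      rintro ⟨s, t', y⟩ ⟨_, _, _, w, t₀, T, C, t, hw, hM, ht, hTt, hwt, hC⟩ hsM hτt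
      dsimp only at hM hTt hwt hsM hτt ⊢
      rcases le_total s C with hsC | hsC
      · have := hw.le_max hr ha ha_lt hρ hM t ⟨by linarith [ht.1, hw.le], ht.2⟩
        rw [max_eq_right hsC] at this
        linarith
      · have hb : ∀ q ∈ Icc (t₀ - r) t, w q ≤ max M 1 := fun q hq =>
          ((hw.le_max hr ha ha_lt hρ hM q ⟨hq.1, hq.2.trans ht.2⟩).trans
            (max_le le_rfl hsC)).trans (hsM.trans (le_max_left _ _))
        have := hτ w t₀ t C (hw.restrict le_rfl (by linarith [ht.1]) ht.2) hb (by linarith [ht.1])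
        rcases le_max_iff.1 this with h | h
        · linarith
        · linarith)
  refine ⟨σ, hσ, fun w t₀ T C M hw hM s hs => ?_⟩
  have hwle := hw.le
  rcases le_or_gt (w s) C with hC | hC
  · exact hC.trans (le_max_right _ _)
  · have hM0 : 0 ≤ M := (hw.nonneg t₀ ⟨by linarith, hw.le⟩).trans (hM t₀ ⟨by linarith, le_rfl⟩)
    have h1 : w s ≤ M := by
      rcases le_max_iff.1 (hw.le_max hr ha ha_lt hρ hM s ⟨by linarith [hs.1], hs.2⟩) with h | h
      · exact h
      · linarith
    exact (hle (M, T - t₀, w s) ⟨hM0, by simpa using hw.le, h1, w, t₀, T, C, s, hw, hM, hs, rfl,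
      rfl, hC⟩).trans (le_max_left _ _)

/-! ### Absolute continuity of compositions -/

open AbsolutelyContinuousOnInterval in
-- Serves for Lipschitz functions of time and of the curve, such as `V t (x t)`; the increments over
-- disjoint intervals are summed term by term.
theorem AbsolutelyContinuousOnInterval.of_dist_le {X Y : Type*} [PseudoMetricSpace X]
    [PseudoMetricSpace Y] {f : ℝ → X} {g : ℝ → Y} {a b K : ℝ}
    (hf : AbsolutelyContinuousOnInterval f a b)
    (h : ∀ s ∈ uIcc a b, ∀ t ∈ uIcc a b, dist (g s) (g t) ≤ K * (dist s t + dist (f s) (f t))) :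
    AbsolutelyContinuousOnInterval g a b := by
  have h1 : Tendsto (fun E : ℕ × (ℕ → ℝ × ℝ) =>
      ∑ i ∈ Finset.range E.1, dist (E.2 i).1 (E.2 i).2)
      (totalLengthFilter ⊓ 𝓟 (disjWithin a b)) (𝓝 0) := tendsto_comap.mono_left inf_le_left
  have h2 := (h1.add hf).const_mul K
  rw [add_zero, mul_zero] at h2
  refine squeeze_zero' (Eventually.of_forall fun E => Finset.sum_nonneg fun i _ => dist_nonneg) ?_ h2
  filter_upwards [mem_inf_of_right (mem_principal_self _)] with E hE
  rw [← Finset.sum_add_distrib, Finset.mul_sum]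
  exact Finset.sum_le_sum fun i hi => h _ (hE.1 i hi).1 _ (hE.1 i hi).2

theorem AbsolutelyContinuousOnInterval.refl {X : Type*} [PseudoMetricSpace X] (f : ℝ → X) (a : ℝ) :
    AbsolutelyContinuousOnInterval f a a :=
  LipschitzOnWith.absolutelyContinuousOnInterval (K := 0) (by
    rw [uIcc_self]; intro x hx y hy
    rw [mem_singleton_iff.1 hx, mem_singleton_iff.1 hy]; simp)

/-! ### Histories -/

theorem history_apply_of_continuousOn {r : ℝ≥0} {n : ℕ} {x : ℝ → Euc n} {t : ℝ}
    (hx : ContinuousOn x (Icc (t - r) t)) (θ : Icc (-(r : ℝ)) (0 : ℝ)) :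
    history r x t θ = x (t + θ) := by
  have : Continuous fun θ : Icc (-(r : ℝ)) (0 : ℝ) => x (t + θ) :=
    hx.comp_continuous (by fun_prop) fun θ => ⟨by linarith [θ.2.1], by linarith [θ.2.2]⟩
  simp only [history, this, dif_pos, ContinuousMap.coe_mk]

theorem history_zero_of_continuousOn {r : ℝ≥0} {n : ℕ} {x : ℝ → Euc n} {t : ℝ}
    (hx : ContinuousOn x (Icc (t - r) t)) : history r x t (histZero r) = x t := by
  rw [history_apply_of_continuousOn hx]; simp [histZero]

theorem norm_history_le {r : ℝ≥0} {n : ℕ} {x : ℝ → Euc n} {t B : ℝ}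
    (hx : ContinuousOn x (Icc (t - r) t)) (hB : ∀ s ∈ Icc (t - r) t, ‖x s‖ ≤ B) :
    ‖history r x t‖ ≤ B := by
  have h0 : 0 ≤ B := (norm_nonneg _).trans (hB t ⟨by linarith [r.2], le_rfl⟩)
  rw [ContinuousMap.norm_le _ h0]
  intro θ
  rw [history_apply_of_continuousOn hx]
  exact hB _ ⟨by linarith [θ.2.1], by linarith [θ.2.2]⟩

theorem continuousOn_lyapunov {n : ℕ} {r : ℝ} {V : ℝ → Euc n → ℝ}
    (hV : ContinuousOn (fun p : ℝ × Euc n => V p.1 p.2) (Ici (-r) ×ˢ univ)) {x : ℝ → Euc n}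
    {s : Set ℝ} (hs : s ⊆ Ici (-r)) (hx : ContinuousOn x s) :
    ContinuousOn (fun t => V t (x t)) s :=
  hV.comp (continuousOn_id.prodMk hx) fun _ ht => ⟨hs ht, mem_univ _⟩

theorem bddAbove_range_supHist {n : ℕ} {r : ℝ≥0} {V : ℝ → Euc n → ℝ}
    (hV : ContinuousOn (fun p : ℝ × Euc n => V p.1 p.2) (Ici (-(r : ℝ)) ×ˢ univ)) {t : ℝ}
    (ht : 0 ≤ t) (x : Hist r n) :
    BddAbove (range fun θ : Icc (-(r : ℝ)) (0 : ℝ) => V (t + θ) (x θ)) := by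
  have : Continuous fun θ : Icc (-(r : ℝ)) (0 : ℝ) => V (t + θ) (x θ) :=
    hV.comp_continuous (f := fun θ : Icc (-(r : ℝ)) (0 : ℝ) => ((t + θ : ℝ), x θ)) (by fun_prop)
      fun θ => ⟨mem_Ici.2 (by linarith [θ.2.1]), mem_univ _⟩
  exact isCompact_range this |>.bddAbove

theorem supHist_le {n : ℕ} {r : ℝ≥0} {V : ℝ → Euc n → ℝ} {t B : ℝ} {x : Hist r n}
    (h : ∀ θ : Icc (-(r : ℝ)) (0 : ℝ), V (t + θ) (x θ) ≤ B) : supHist r V t x ≤ B :=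
  haveI : Nonempty (Icc (-(r : ℝ)) (0 : ℝ)) := ⟨histZero r⟩
  ciSup_le h

theorem exists_supHist_eq {n : ℕ} {r : ℝ≥0} {V : ℝ → Euc n → ℝ}
    (hV : ContinuousOn (fun p : ℝ × Euc n => V p.1 p.2) (Ici (-(r : ℝ)) ×ˢ univ)) {t : ℝ}
    (ht : 0 ≤ t) (x : Hist r n) : ∃ θ : Icc (-(r : ℝ)) (0 : ℝ), supHist r V t x = V (t + θ) (x θ) := by
  have hc : Continuous fun θ : Icc (-(r : ℝ)) (0 : ℝ) => V (t + θ) (x θ) :=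
    hV.comp_continuous (f := fun θ : Icc (-(r : ℝ)) (0 : ℝ) => ((t + θ : ℝ), x θ)) (by fun_prop)
      fun θ => ⟨mem_Ici.2 (by linarith [θ.2.1]), mem_univ _⟩
  obtain ⟨θ, _, hθ⟩ := isCompact_univ.exists_isMaxOn ⟨histZero r, mem_univ _⟩ hc.continuousOn
  exact ⟨θ, le_antisymm (supHist_le fun s => hθ (mem_univ s))
    (le_ciSup (bddAbove_range_supHist hV ht x) θ)⟩

/-! ### Dini derivative along a differentiable curve -/

/-- The curve and its tangent line differ by `o(h)` at time `t + h`, and the Lipschitz property of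
`V` keeps this error `o(h)`. Hence the difference quotient along the line has a limit, namely the
derivative along the curve. -/
theorem diniDeriv_eq_deriv {n : ℕ} {r : ℝ} {V : ℝ → Euc n → ℝ}
    (hV : LocallyLipschitzOn (Ici (-r) ×ˢ univ) (fun p : ℝ × Euc n => V p.1 p.2))
    {x : ℝ → Euc n} {t : ℝ} {F : Euc n} (ht : -r ≤ t) (hx : HasDerivAt x F t)
    (hw : DifferentiableAt ℝ (fun s => V s (x s)) t) :
    diniDeriv V t (x t) F = ((deriv (fun s => V s (x s)) t : ℝ) : EReal) := by
  obtain ⟨K, U, hU, hK⟩ := hV (show (t, x t) ∈ Ici (-r) ×ˢ univ from ⟨ht, mem_univ _⟩)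
  have hsl := (hasDerivAt_iff_tendsto_slope_zero.1 hw.hasDerivAt).mono_left
    (nhdsWithin_mono 0 fun h (hh : (0 : ℝ) < h) => hh.ne')
  have hslx := (hasDerivAt_iff_tendsto_slope_zero.1 hx).mono_left
    (nhdsWithin_mono 0 fun h (hh : (0 : ℝ) < h) => hh.ne')
  have hid : Tendsto (fun h : ℝ => h) (𝓝[>] 0) (𝓝 0) := nhdsWithin_le_nhds
  have hth : Tendsto (fun h : ℝ => t + h) (𝓝[>] 0) (𝓝 t) := by
    simpa using hid.const_add t
  have hpos : ∀ᶠ h : ℝ in 𝓝[>] 0, 0 < h := self_mem_nhdsWithin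
  have h1 : ∀ᶠ h : ℝ in 𝓝[>] 0, (t + h, x (t + h)) ∈ U := by
    refine Tendsto.eventually_mem (f := fun h : ℝ => (t + h, x (t + h))) ?_ hU
    refine tendsto_nhdsWithin_iff.2 ⟨hth.prodMk_nhds (hx.continuousAt.tendsto.comp hth), ?_⟩
    filter_upwards [hpos] with h hh using ⟨mem_Ici.2 (by linarith), mem_univ _⟩
  have h2 : ∀ᶠ h : ℝ in 𝓝[>] 0, (t + h, x t + h • F) ∈ U := by
    refine Tendsto.eventually_mem (f := fun h : ℝ => (t + h, x t + h • F)) ?_ hU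
    refine tendsto_nhdsWithin_iff.2 ⟨hth.prodMk_nhds ?_, ?_⟩
    · simpa using (hid.smul_const F).const_add (x t)
    · filter_upwards [hpos] with h hh using ⟨mem_Ici.2 (by linarith), mem_univ _⟩
  have herr : Tendsto (fun h : ℝ => (V (t + h) (x t + h • F) - V (t + h) (x (t + h))) / h)
      (𝓝[>] 0) (𝓝 0) := by
    have hb : Tendsto (fun h : ℝ => K * ‖h⁻¹ • (x (t + h) - x t) - F‖) (𝓝[>] 0) (𝓝 0) := by
      have := ((hslx.sub_const F).norm).const_mul (K : ℝ)
      rwa [sub_self, norm_zero, mul_zero] at this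
    refine squeeze_zero_norm' ?_ hb
    filter_upwards [h1, h2, hpos] with h hh1 hh2 hh
    have h3 := hK.dist_le_mul _ hh2 _ hh1
    rw [Real.dist_eq, Prod.dist_eq] at h3
    simp only [dist_self] at h3
    rw [max_eq_right dist_nonneg, dist_eq_norm] at h3
    rw [Real.norm_eq_abs, abs_div, abs_of_pos hh, div_le_iff₀ hh]
    refine h3.trans_eq ?_
    have h4 : x t + h • F - x (t + h) = -(h • (h⁻¹ • (x (t + h) - x t) - F)) := by
      rw [smul_sub, smul_inv_smul₀ hh.ne']; abel
    rw [h4, norm_neg, norm_smul, Real.norm_eq_abs, abs_of_pos hh]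
    ring
  have hlim := hsl.add herr
  rw [add_zero] at hlim
  have hlim' : Tendsto (fun h : ℝ => (V (t + h) (x t + h • F) - V t (x t)) / h) (𝓝[>] 0)
      (𝓝 (deriv (fun s => V s (x s)) t)) := by
    refine hlim.congr' ?_
    filter_upwards [hpos] with h hh
    rw [smul_eq_mul]
    field_simp
    ring
  exact ((continuous_coe_real_ereal.tendsto _).comp hlim').limsup_eq

/-! ### Lyapunov functions along solutions -/

namespace RFDESystem

variable {l m n k₁ k₂ : ℕ} {S : RFDESystem l m n k₁ k₂}

theorem IsSolution.continuousOn_Icc {t₀ : ℝ} {T : EReal} {x₀ : Hist S.r n} {v : ℝ → Euc k₂}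
    {u : ℝ → Euc m} {d : ℝ → Euc l} {x : ℝ → Euc n} (hx : S.IsSolution t₀ T x₀ v u d x)
    {s c : ℝ} (hs : t₀ - S.r ≤ s) (hc : (c : EReal) < T) : ContinuousOn x (Icc s c) :=
  hx.cont.mono fun _ ht => ⟨hs.trans ht.1, (EReal.coe_le_coe_iff.2 ht.2).trans_lt hc⟩

theorem IsSolution.apply_init {t₀ : ℝ} {T : EReal} {x₀ : Hist S.r n} {v : ℝ → Euc k₂}
    {u : ℝ → Euc m} {d : ℝ → Euc l} {x : ℝ → Euc n} (hx : S.IsSolution t₀ T x₀ v u d x)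
    {s : ℝ} (hs : s ∈ Icc (t₀ - S.r) t₀) :
    x s = x₀ ⟨s - t₀, by linarith [hs.1], by linarith [hs.2]⟩ := by
  rw [← hx.init]; simp

theorem IsSolution.absolutelyContinuousOnInterval {t₀ : ℝ} {T : EReal} {x₀ : Hist S.r n}
    {v : ℝ → Euc k₂} {u : ℝ → Euc m} {d : ℝ → Euc l} {x : ℝ → Euc n}
    (hx : S.IsSolution t₀ T x₀ v u d x) {c : ℝ} (h0 : t₀ ≤ c) (hc : (c : EReal) < T) :
    AbsolutelyContinuousOnInterval x t₀ c := by
  rcases h0.eq_or_lt with rfl | h0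
  · exact .refl _ _
  · exact hx.abs_cont c h0 hc

/-- The transfer from the system to a scalar inequality. `V` is Lipschitz on the compact graph of
`x` over `[t₀, c]`, which makes `V t (x t)` absolutely continuous; the decrease condition is then
read at almost every time. -/
theorem IsSolution.razumikhinDecay {V : ℝ → Euc n → ℝ} {a ζ ζu δ δu ρ : ℝ → ℝ}
    (hV_nonneg : ∀ t, -(S.r : ℝ) ≤ t → ∀ x, 0 ≤ V t x)
    (hV_lip : LocallyLipschitzOn (Ici (-(S.r : ℝ)) ×ˢ univ) (fun p : ℝ × Euc n => V p.1 p.2))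
    (hζ : ClassN ζ) (hδ : ClassKPlus δ)
    (hV_decr : ∀ t, 0 ≤ t → ∀ x : Hist S.r n, ∀ u ∈ S.U, ∀ v ∈ S.S₂, ∀ d ∈ S.D,
      max (ζ (δ t * ‖v‖)) (max (ζu (δu t * ‖u‖)) (a (supHist S.r V t x)))
        ≤ V t (x (histZero S.r)) →
      diniDeriv V t (x (histZero S.r)) (S.f t d x u v)
        ≤ ((-ρ (V t (x (histZero S.r))) : ℝ) : EReal))
    {t₀ : ℝ} {T : EReal} {x₀ : Hist S.r n} {v : ℝ → Euc k₂} {u : ℝ → Euc m} {d : ℝ → Euc l}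
    {x : ℝ → Euc n} (hadm : S.Admissible t₀ v u d) (hx : S.IsSolution t₀ T x₀ v u d x)
    {c C : ℝ} (h0 : t₀ ≤ c) (hc : (c : EReal) < T)
    (hv : ∀ τ ∈ Icc t₀ c, ζ (δ τ * ‖v τ‖) ≤ C) (hu : ∀ τ ∈ Icc t₀ c, ζu (δu τ * ‖u τ‖) ≤ C) :
    RazumikhinDecay S.r a ρ (fun t => V t (x t)) t₀ c C := by
  obtain ⟨ht₀, hvI, huI, hdI⟩ := hadm
  have hVc := hV_lip.continuousOn
  have hr : (0 : ℝ) ≤ S.r := S.r.2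
  have hxc : ContinuousOn x (Icc (t₀ - S.r) c) := hx.continuousOn_Icc le_rfl hc
  have hac : AbsolutelyContinuousOnInterval (fun t => V t (x t)) t₀ c := by
    have hcpt : IsCompact ((fun t => (t, x t)) '' Icc t₀ c) := isCompact_Icc.image_of_continuousOn
      (continuousOn_id.prodMk (hx.continuousOn_Icc (by linarith) hc))
    have hsub : (fun t => (t, x t)) '' Icc t₀ c ⊆ Ici (-(S.r : ℝ)) ×ˢ univ := by
      rintro _ ⟨t, ht, rfl⟩
      exact ⟨mem_Ici.2 (by linarith [ht.1]), mem_univ _⟩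
    obtain ⟨K, hK⟩ := (hV_lip.mono hsub).exists_lipschitzOnWith_of_compact hcpt
    refine (hx.absolutelyContinuousOnInterval h0 hc).of_dist_le (K := K) fun s hs t ht => ?_
    rw [uIcc_of_le h0] at hs ht
    refine (hK.dist_le_mul _ (mem_image_of_mem _ hs) _ (mem_image_of_mem _ ht)).trans ?_
    rw [Prod.dist_eq]
    gcongr
    exact max_le (by linarith [dist_nonneg (x := x s) (y := x t)])
      (by linarith [dist_nonneg (x := s) (y := t)])
  refine ⟨h0, ?_, continuousOn_lyapunov hVc (fun s hs => mem_Ici.2 (by linarith [hs.1])) hxc,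
    fun s hs => hV_nonneg s (by linarith [hs.1]) _, hac, ?_⟩
  · exact (hζ.nonneg (mul_nonneg (hδ.2 t₀ ht₀).le (norm_nonneg _))).trans (hv t₀ ⟨le_rfl, h0⟩)
  · filter_upwards [hx.ode, hac.ae_differentiableAt] with t hode hdiff ht hCt hat
    have htI : t ∈ Icc t₀ c := ⟨ht.1.le, ht.2.le⟩
    have ht0 : 0 ≤ t := ht₀.trans ht.1.le
    have hode := hode ht.1.le ((EReal.coe_lt_coe_iff.2 ht.2).trans hc)
    have hdiff := hdiff (by rwa [uIcc_of_le h0])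
    have hxt : ContinuousOn x (Icc (t - S.r) t) :=
      hxc.mono (Icc_subset_Icc (by linarith [ht.1]) ht.2.le)
    have hD := hV_decr t ht0 (history S.r x t) (u t) (huI.1 t ht0) (v t) (hvI.1 t ht0) (d t)
      (hdI.1 t ht0)
    rw [history_zero_of_continuousOn hxt] at hD
    have := hD (max_le ((hv t htI).trans hCt) (max_le ((hu t htI).trans hCt) (by
      -- The supremum over the history is attained, so `a` of it is `a` of a single past value.
      obtain ⟨θ, hθ⟩ := exists_supHist_eq hVc ht0 (history S.r x t)
      rw [hθ, history_apply_of_continuousOn hxt]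
      exact hat _ ⟨by linarith [θ.2.1], by linarith [θ.2.2]⟩)))
    rw [diniDeriv_eq_deriv hV_lip (by linarith) hode hdiff] at this
    exact EReal.coe_le_coe_iff.1 this

/-- Inputs are bounded on bounded intervals, hence so are their images under comparison functions. -/
theorem bddAbove_range_gain {k : ℕ} {Ω : Set (Euc k)} {w : ℝ → Euc k} (hw : IsInput Ω w)
    {γ δ : ℝ → ℝ} (hγ : MonotoneOn γ (Ici 0)) (hδ : ContinuousOn δ (Ici 0))
    (hδ0 : ∀ t, 0 ≤ t → 0 ≤ δ t) {t₀ t : ℝ} (ht₀ : 0 ≤ t₀) :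
    BddAbove (range fun τ : Icc t₀ t => γ (δ τ * ‖w τ‖)) := by
  obtain ⟨M, hM⟩ := hw.2.2 t
  obtain ⟨B, hB⟩ := isCompact_Icc.bddAbove_image (hδ.mono (fun s hs => ht₀.trans hs.1 :
    Icc t₀ t ⊆ Ici 0))
  refine ⟨γ (B * M), ?_⟩
  rintro _ ⟨τ, rfl⟩
  have h0 : 0 ≤ (τ : ℝ) := ht₀.trans τ.2.1
  have h1 : δ τ ≤ B := hB (mem_image_of_mem _ τ.2)
  have h2 := hM τ ⟨h0, τ.2.2⟩
  have h3 := hδ0 τ h0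
  have h4 := norm_nonneg (w τ)
  exact hγ (mem_Ici.2 (by positivity)) (mem_Ici.2 (mul_nonneg (h3.trans h1) (h4.trans h2)))
    (mul_le_mul h1 h2 h4 (h3.trans h1))

end RFDESystem

/-! ### Running suprema of continuous functions -/

/-- The running supremum `sup_{[0, t + r]} f`. -/
theorem ClassKPlus.iSup {f : ℝ → ℝ} (hf : ClassKPlus f) {r : ℝ} (hr : 0 ≤ r) :
    ClassKPlus fun t => ⨆ τ : Icc (0 : ℝ) (t + r), f τ := by
  -- Rescaling `[0, t + r]` to the fixed compact interval `[0, 1]` makes the supremum continuous in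
  -- `t`; the maxima with `0` extend `f` continuously off the half-line.
  have hext : Continuous fun p : ℝ × ℝ => f (max 0 (p.1 + r) * max 0 p.2) :=
    hf.1.comp_continuous (by fun_prop) fun p => mem_Ici.2 (by positivity)
  have hcont := isCompact_Icc.continuous_sSup (K := Icc (0 : ℝ) 1)
    (f := fun t s => f (max 0 (t + r) * max 0 s)) hext
  have heq : ∀ t, 0 ≤ t → (fun s => f (max 0 (t + r) * max 0 s)) '' Icc (0 : ℝ) 1 =
      range fun τ : Icc (0 : ℝ) (t + r) => f τ := by
    intro t ht
    have htr : 0 ≤ t + r := by positivity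
    ext y
    constructor
    · rintro ⟨s, hs, rfl⟩
      refine ⟨⟨(t + r) * s, mul_nonneg htr hs.1, mul_le_of_le_one_right htr hs.2⟩, ?_⟩
      simp only [max_eq_right htr, max_eq_right hs.1]
    · rintro ⟨⟨τ, hτ⟩, rfl⟩
      rcases htr.eq_or_lt with h | h
      · refine ⟨0, ⟨le_rfl, zero_le_one⟩, ?_⟩
        have : τ = 0 := le_antisymm (hτ.2.trans h.symm.le) hτ.1
        simp [this]
      · refine ⟨τ / (t + r), ⟨div_nonneg hτ.1 htr, (div_le_one h).2 hτ.2⟩, ?_⟩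
        simp only [max_eq_right htr, max_eq_right (div_nonneg hτ.1 htr)]
        rw [mul_div_cancel₀ _ h.ne']
  refine ⟨hcont.continuousOn.congr fun t ht => ?_, fun t ht => ?_⟩
  · show _ = sSup _
    rw [heq t ht]
    rfl
  · have hbdd : BddAbove (range fun τ : Icc (0 : ℝ) (t + r) => f τ) := by
      rw [← image_eq_range]
      exact isCompact_Icc.bddAbove_image (hf.1.mono Icc_subset_Ici_self)
    exact (hf.2 0 le_rfl).trans_le (le_ciSup hbdd ⟨0, le_rfl, by positivity⟩)

theorem ClassKPlus.le_iSup {f : ℝ → ℝ} (hf : ClassKPlus f) {s t : ℝ} (h0 : 0 ≤ s) (hst : s ≤ t) :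
    f s ≤ ⨆ τ : Icc (0 : ℝ) t, f τ := by
  have hbdd : BddAbove (range fun τ : Icc (0 : ℝ) t => f τ) := by
    rw [← image_eq_range]
    exact isCompact_Icc.bddAbove_image (hf.1.mono Icc_subset_Ici_self)
  exact le_ciSup hbdd ⟨s, h0, hst⟩

theorem ClassKPlus.iSup_mono {f : ℝ → ℝ} (hf : ClassKPlus f) {s t : ℝ} (h0 : 0 ≤ s) (hst : s ≤ t) :
    ⨆ τ : Icc (0 : ℝ) s, f τ ≤ ⨆ τ : Icc (0 : ℝ) t, f τ :=
  haveI : Nonempty (Icc (0 : ℝ) s) := ⟨⟨0, le_rfl, h0⟩⟩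
  ciSup_le fun τ => hf.le_iSup τ.2.1 (τ.2.2.trans hst)

/-! ### The output estimate -/

namespace RFDESystem

variable {l m n k₁ k₂ : ℕ} {S : RFDESystem l m n k₁ k₂}

/-- The upper bound for `V` is shifted by the delay: at time `s` it involves `β (s + r)`, and `s +
r` runs up to `t₀ + r` on the initial interval. -/
theorem IsSolution.lyapunov_init_le {V : ℝ → Euc n → ℝ} {a₂ β : ℝ → ℝ} (ha₂ : ClassK a₂)
    (hβ : ClassKPlus β) (hV_upper : ∀ t, 0 ≤ t → ∀ x, V (t - S.r) x ≤ a₂ (β t * ‖x‖))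
    {t₀ : ℝ} {T : EReal} {x₀ : Hist S.r n} {v : ℝ → Euc k₂} {u : ℝ → Euc m} {d : ℝ → Euc l}
    {x : ℝ → Euc n} (ht₀ : 0 ≤ t₀) (hx : S.IsSolution t₀ T x₀ v u d x) :
    ∀ s ∈ Icc (t₀ - S.r) t₀,
      V s (x s) ≤ a₂ ((⨆ τ : Icc (0 : ℝ) (t₀ + S.r), β τ) * ‖x₀‖) := by
  intro s hs
  have h0 : 0 ≤ s + S.r := by linarith [hs.1]
  have h1 := hV_upper (s + S.r) h0 (x s)
  rw [add_sub_cancel_right] at h1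
  refine h1.trans (ha₂.mono (mul_nonneg (hβ.2 _ h0).le (norm_nonneg _)) ?_)
  have h2 : β (s + S.r) ≤ _ := hβ.le_iSup h0 (by linarith [hs.2] : s + S.r ≤ t₀ + S.r)
  have h3 : ‖x s‖ ≤ ‖x₀‖ := by rw [hx.apply_init hs]; exact ContinuousMap.norm_coe_le_norm _ _
  exact mul_le_mul h2 h3 (norm_nonneg _) ((hβ.2 _ h0).le.trans h2)

/-- The output estimate along every global solution. -/
theorem exists_classKL_outputEstimate {V : ℝ → Euc n → ℝ} {a₁ a₂ a ζ ζu β δ δu ρ : ℝ → ℝ}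
    (hV_nonneg : ∀ t, -(S.r : ℝ) ≤ t → ∀ x, 0 ≤ V t x)
    (hV_lip : LocallyLipschitzOn (Ici (-(S.r : ℝ)) ×ˢ univ) (fun p : ℝ × Euc n => V p.1 p.2))
    (ha₂ : ClassKInf a₂) (ha : ClassKInf a) (ha_lt : ∀ s, 0 < s → a s < s)
    (hζ : ClassN ζ) (hζu : ClassN ζu)
    (hβ : ClassKPlus β) (hδ : ClassKPlus δ) (hδu : ClassKPlus δu)
    (hρ : PosDefFun ρ) (hρ_cont : ContinuousOn ρ (Ici 0))
    (hV_upper : ∀ t, 0 ≤ t → ∀ x, V (t - S.r) x ≤ a₂ (β t * ‖x‖))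
    (hV_decr : ∀ t, 0 ≤ t → ∀ x : Hist S.r n, ∀ u ∈ S.U, ∀ v ∈ S.S₂, ∀ d ∈ S.D,
      max (ζ (δ t * ‖v‖)) (max (ζu (δu t * ‖u‖)) (a (supHist S.r V t x)))
        ≤ V t (x (histZero S.r)) →
      diniDeriv V t (x (histZero S.r)) (S.f t d x u v)
        ≤ ((-ρ (V t (x (histZero S.r))) : ℝ) : EReal))
    (ha₁ : ClassKInf a₁)
    (hH : ∀ t, 0 ≤ t → ∀ x : Hist S.r n, a₁ ‖S.H t x‖ ≤ supHist S.r V t x) :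
    ∃ σ₁ : ℝ → ℝ → ℝ, ClassKL σ₁ ∧
      ∀ t₀ x₀ v u d, S.Admissible t₀ v u d →
        ∀ x, S.IsGlobalSolution t₀ x₀ v u d x →
          S.OutputEstimate σ₁ (fun t => ⨆ τ : Icc (0 : ℝ) (t + S.r), β τ)
            (fun s => kInv a₁ (ζ s)) δ (fun s => kInv a₁ (ζu s)) δu t₀ x₀ v u x := by
  obtain ⟨σ, hσ, hle⟩ := exists_classKL_razumikhin (r := (S.r : ℝ)) S.r.2 ha.1 ha_lt hρ hρ_cont
  refine ⟨fun s t => kInv a₁ (σ (a₂ s) t), hσ.comp ha₁.classK_kInv ha₂.1, ?_⟩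
  intro t₀ x₀ v u d hadm x hx t ht
  have ht₀ : 0 ≤ t₀ := hadm.1
  have hcT : (t : EReal) < ⊤ := EReal.coe_lt_top t
  have gain : ∀ {k : ℕ} {Ω : Set (Euc k)} {w : ℝ → Euc k} {ζ δ : ℝ → ℝ}, IsInput Ω w → ClassN ζ →
      ClassKPlus δ → ∀ τ ∈ Icc t₀ t, 0 ≤ kInv a₁ (ζ (δ τ * ‖w τ‖)) ∧
        kInv a₁ (ζ (δ τ * ‖w τ‖)) ≤ ⨆ τ : Icc t₀ t, kInv a₁ (ζ (δ τ * ‖w τ‖)) := by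
    intro k Ω w ζ δ hw hζ hδ τ hτ
    refine ⟨ha₁.kInv_nonneg (hζ.nonneg (mul_nonneg (hδ.2 τ (ht₀.trans hτ.1)).le (norm_nonneg _))),
      ?_⟩
    exact le_ciSup (bddAbove_range_gain (γ := fun s => kInv a₁ (ζ s)) hw
      (fun s hs t ht hst => ha₁.classK_kInv.mono (hζ.nonneg hs) (hζ.1 hs ht hst)) hδ.1
      (fun t ht => (hδ.2 t ht).le) ht₀) ⟨τ, hτ⟩
  set B₁ := ⨆ τ : Icc t₀ t, kInv a₁ (ζ (δ τ * ‖v τ‖)) with hB₁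
  set B₂ := ⨆ τ : Icc t₀ t, kInv a₁ (ζu (δu τ * ‖u τ‖)) with hB₂
  have hB₁0 : 0 ≤ B₁ := (gain hadm.2.1 hζ hδ t₀ ⟨le_rfl, ht⟩).1.trans
    (gain hadm.2.1 hζ hδ t₀ ⟨le_rfl, ht⟩).2
  have hB₂0 : 0 ≤ B₂ := (gain hadm.2.2.1 hζu hδu t₀ ⟨le_rfl, ht⟩).1.trans
    (gain hadm.2.2.1 hζu hδu t₀ ⟨le_rfl, ht⟩).2
  -- This level dominates the gains because `kInv a₁ y ≤ B` means `y ≤ a₁ B`, and applying `a₁⁻¹` to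
  -- it returns `B₁` or `B₂` at the end.
  have hdec := hx.razumikhinDecay (a := a) (c := t) (C := max (a₁ B₁) (a₁ B₂))
    hV_nonneg hV_lip hζ hδ hV_decr hadm ht hcT
    (fun τ hτ => ((ha₁.kInv_le_iff (hζ.nonneg (mul_nonneg (hδ.2 τ (ht₀.trans hτ.1)).le
      (norm_nonneg _))) hB₁0).1 (gain hadm.2.1 hζ hδ τ hτ).2).trans (le_max_left _ _))
    (fun τ hτ => ((ha₁.kInv_le_iff (hζu.nonneg (mul_nonneg (hδu.2 τ (ht₀.trans hτ.1)).le
      (norm_nonneg _))) hB₂0).1 (gain hadm.2.2.1 hζu hδu τ hτ).2).trans (le_max_right _ _))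
  have hb := hle _ t₀ t _ _ hdec (hx.lyapunov_init_le ha₂.1 hβ hV_upper ht₀)
  set s₀ := (⨆ τ : Icc (0 : ℝ) (t₀ + S.r), β τ) * ‖x₀‖ with hs₀
  have hs₀0 : 0 ≤ s₀ := mul_nonneg ((hβ.iSup S.r.2).2 t₀ ht₀).le (norm_nonneg _)
  have hσ0 : 0 ≤ σ (a₂ s₀) (t - t₀) := hσ.nonneg (ha₂.1.nonneg hs₀0) (by linarith)
  have hxt : ContinuousOn x (Icc (t - S.r) t) :=
    hx.continuousOn_Icc (by linarith) hcT
  have h1 : a₁ ‖S.H t (history S.r x t)‖ ≤ max (σ (a₂ s₀) (t - t₀)) (max (a₁ B₁) (a₁ B₂)) := by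
    refine (hH t (ht₀.trans ht) _).trans (supHist_le fun θ => ?_)
    rw [history_apply_of_continuousOn hxt]
    exact hb _ ⟨by linarith [θ.2.1], by linarith [θ.2.2]⟩
  have hk0 : 0 ≤ kInv a₁ (σ (a₂ s₀) (t - t₀)) := ha₁.kInv_nonneg hσ0
  show ‖S.H t (history S.r x t)‖ ≤ kInv a₁ (σ (a₂ s₀) (t - t₀)) + B₁ + B₂
  rcases le_max_iff.1 h1 with h | h
  · have := (ha₁.le_kInv_iff hσ0 (norm_nonneg _)).2 h
    linarith
  · rcases le_max_iff.1 h with h | h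
    · have := (ha₁.1.le_iff_le (norm_nonneg _) hB₁0).1 h
      linarith
    · have := (ha₁.1.le_iff_le (norm_nonneg _) hB₂0).1 h
      linarith

end RFDESystem

/-! ### Stability estimate for absolutely continuous curves -/

theorem AbsolutelyContinuousOnInterval.norm_sq {E : Type*} [NormedAddCommGroup E]
    [NormedSpace ℝ E] {z : ℝ → E} {a b : ℝ} (hz : AbsolutelyContinuousOnInterval z a b) :
    AbsolutelyContinuousOnInterval (fun t => ‖z t‖ ^ 2) a b := by
  obtain ⟨B, hB⟩ := hz.exists_bound
  have hB0 : 0 ≤ B := (norm_nonneg _).trans (hB a left_mem_uIcc)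
  refine hz.of_dist_le (K := 2 * B) fun s hs t ht => ?_
  have h1 := hB s hs
  have h2 := hB t ht
  have h3 := abs_norm_sub_norm_le (z s) (z t)
  have h4 : 0 ≤ dist s t := dist_nonneg
  rw [Real.dist_eq, show ‖z s‖ ^ 2 - ‖z t‖ ^ 2 = (‖z s‖ + ‖z t‖) * (‖z s‖ - ‖z t‖) by ring, abs_mul,
    abs_of_nonneg (by positivity)]
  rw [← dist_eq_norm] at h3
  exact mul_le_mul (by linarith) (by linarith) (abs_nonneg _) (by linarith)

/-- The energy estimate behind both existence and uniqueness: `(‖z‖²)' = 2⟨z, z'⟩`, so a one-sided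
bound is enough for Gronwall. The running bound on `‖z‖` handles the delay. -/
theorem AbsolutelyContinuousOnInterval.norm_sq_le_of_inner_le {E : Type*} [NormedAddCommGroup E]
    [InnerProductSpace ℝ E] {z : ℝ → E} {t₀ T K ε : ℝ} (hK : 0 ≤ K) (hε : 0 < ε) (hT : t₀ ≤ T)
    (hz : AbsolutelyContinuousOnInterval z t₀ T) (h0 : z t₀ = 0)
    (h : ∀ᵐ t, t ∈ Ioo t₀ T → ∀ b, 0 ≤ b → (∀ s ∈ Icc t₀ t, ‖z s‖ ≤ b) →
      ∃ z', HasDerivAt z z' t ∧ inner ℝ (z t) z' ≤ K * b ^ 2 + ε) :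
    ∀ t ∈ Icc t₀ T, ‖z t‖ ^ 2 ≤ 2 * ε * Real.exp ((2 * K + 1) * (t - t₀)) := by
  refine hz.norm_sq.le_mul_exp (by positivity) (by positivity) hT (by simp [h0]) ?_
  filter_upwards [h] with t ht htI b hb hle
  obtain ⟨z', hz', hin⟩ := ht htI (√b) (Real.sqrt_nonneg b) fun s hs => Real.le_sqrt_of_sq_le (hle s hs)
  rw [Real.sq_sqrt hb] at hin
  rw [hz'.norm_sq.deriv]
  linarith

/-! ### Histories of continuous curves -/

theorem history_apply {r : ℝ≥0} {n : ℕ} {x : ℝ → Euc n} (hx : Continuous x) (t : ℝ)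
    (θ : Icc (-(r : ℝ)) (0 : ℝ)) : history r x t θ = x (t + θ) :=
  history_apply_of_continuousOn hx.continuousOn θ

theorem continuous_history {r : ℝ≥0} {n : ℕ} {x : ℝ → Euc n} (hx : Continuous x) :
    Continuous fun t => history r x t := by
  refine ContinuousMap.continuous_of_continuous_uncurry _ ?_
  have : Function.uncurry (fun (t : ℝ) (θ : Icc (-(r : ℝ)) (0 : ℝ)) => history r x t θ) =
      fun p : ℝ × Icc (-(r : ℝ)) (0 : ℝ) => x (p.1 + p.2) := by
    ext1 p; exact history_apply hx _ _
  rw [this]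
  fun_prop

theorem norm_history_sub_le {r : ℝ≥0} {n : ℕ} {x y : ℝ → Euc n} (hx : Continuous x)
    (hy : Continuous y) {s t B : ℝ} (hB : ∀ θ ∈ Icc (-(r : ℝ)) 0, ‖x (s + θ) - y (t + θ)‖ ≤ B) :
    ‖history r x s - history r y t‖ ≤ B := by
  have h0 : 0 ≤ B := (norm_nonneg _).trans (hB 0 ⟨by simp, le_rfl⟩)
  rw [ContinuousMap.norm_le _ h0]
  intro θ
  rw [ContinuousMap.sub_apply, history_apply hx, history_apply hy]
  exact hB θ θ.2

theorem history_congr {r : ℝ≥0} {n : ℕ} {x y : ℝ → Euc n} {t : ℝ}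
    (h : ∀ s ∈ Icc (t - r) t, x s = y s) : history r x t = history r y t := by
  have : (fun θ : Icc (-(r : ℝ)) (0 : ℝ) => x (t + θ)) = fun θ : Icc (-(r : ℝ)) (0 : ℝ) => y (t + θ) := by
    ext1 θ; exact h _ ⟨by linarith [θ.2.1], by linarith [θ.2.2]⟩
  unfold history
  generalize (fun θ : Icc (-(r : ℝ)) (0 : ℝ) => x (t + θ)) = g at this ⊢
  subst this
  rfl

/-! ### Existence for functional differential equations with one-sided Lipschitz right-hand side -/

/-- A right-hand side `F` starting at time `t₀`, measurable along continuous curves of histories,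
continuous in the history, bounded, and one-sided Lipschitz, locally uniformly in time. -/
structure RegularRHS (r : ℝ≥0) (n : ℕ) (t₀ : ℝ) (F : ℝ → Hist r n → Euc n) : Prop where
  meas : ∀ X : ℝ → Hist r n, Continuous X → AEStronglyMeasurable (fun s => F s (X s)) volume
  zero : ∀ s < t₀, ∀ X, F s X = 0
  cont : ∀ s, Continuous (F s)
  bdd : ∀ T, ∃ m, 0 ≤ m ∧ ∀ s ≤ T, ∀ X, ‖F s X‖ ≤ m
  lip : ∀ T, ∃ L, 0 ≤ L ∧ ∀ s ≤ T, ∀ X Y,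
    inner ℝ (X (histZero r) - Y (histZero r)) (F s X - F s Y) ≤ L * ‖X - Y‖ ^ 2

/-- The initial history, extended by constants. -/
noncomputable def initExtend {r : ℝ≥0} {n : ℕ} (t₀ : ℝ) (x₀ : Hist r n) (t : ℝ) : Euc n :=
  IccExtend (neg_nonpos.2 r.2 : -(r : ℝ) ≤ 0) x₀ (t - t₀)

theorem uniformContinuous_initExtend {r : ℝ≥0} {n : ℕ} (t₀ : ℝ) (x₀ : Hist r n) :
    UniformContinuous (initExtend t₀ x₀) := by
  have h1 : UniformContinuous x₀ := CompactSpace.uniformContinuous_of_continuous x₀.continuous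
  have h2 : UniformContinuous (projIcc (-(r : ℝ)) 0 (neg_nonpos.2 r.2)) :=
    (LipschitzWith.projIcc _).uniformContinuous
  exact h1.comp (h2.comp (uniformContinuous_id.sub uniformContinuous_const))

theorem initExtend_add {r : ℝ≥0} {n : ℕ} (t₀ : ℝ) (x₀ : Hist r n) (θ : Icc (-(r : ℝ)) (0 : ℝ)) :
    initExtend t₀ x₀ (t₀ + θ) = x₀ θ := by
  simp only [initExtend, add_sub_cancel_left]
  exact IccExtend_val _ _ θ

theorem initExtend_of_le {r : ℝ≥0} {n : ℕ} {t₀ t : ℝ} (x₀ : Hist r n) (ht : t₀ ≤ t) :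
    initExtend t₀ x₀ t = x₀ (histZero r) :=
  IccExtend_of_right_le _ _ (by linarith)

/-- The integral operator with time lag `h`. -/
noncomputable def lagStep {r : ℝ≥0} {n : ℕ} (F : ℝ → Hist r n → Euc n) (t₀ : ℝ) (x₀ : Hist r n)
    (h : ℝ) (y : ℝ → Euc n) (t : ℝ) : Euc n :=
  initExtend t₀ x₀ t + ∫ s in t₀..t, F s (history r y (s - h))

namespace RegularRHS

variable {r : ℝ≥0} {n : ℕ} {t₀ : ℝ} {F : ℝ → Hist r n → Euc n}

theorem locallyIntegrable (hF : RegularRHS r n t₀ F) {X : ℝ → Hist r n} (hX : Continuous X) :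
    LocallyIntegrable (fun s => F s (X s)) volume := by
  refine (locallyIntegrable_iff).2 fun k hk => ?_
  obtain ⟨T, hT⟩ := hk.bddAbove
  obtain ⟨m, _, hm⟩ := hF.bdd T
  refine Measure.integrableOn_of_bounded (M := m) hk.measure_lt_top.ne (hF.meas X hX) ?_
  filter_upwards [ae_restrict_mem hk.measurableSet] with s hs using hm s (hT hs) _

theorem intervalIntegrable (hF : RegularRHS r n t₀ F) {X : ℝ → Hist r n} (hX : Continuous X)
    (a b : ℝ) : IntervalIntegrable (fun s => F s (X s)) volume a b :=
  intervalIntegrable_iff.2 (((hF.locallyIntegrable hX).integrableOn_isCompact isCompact_uIcc).mono_set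
    uIoc_subset_uIcc)

theorem integral_eq_zero (hF : RegularRHS r n t₀ F) (X : ℝ → Hist r n) {t : ℝ} (ht : t ≤ t₀) :
    ∫ s in t₀..t, F s (X s) = 0 := by
  refine intervalIntegral.integral_zero_ae ?_
  filter_upwards [(by simp [ae_iff, measure_singleton] : ∀ᵐ x : ℝ, x ≠ t₀)] with s hs hst
  rw [uIoc_of_ge ht] at hst
  exact hF.zero s (lt_of_le_of_ne hst.2 hs) _

theorem continuous_shift {y : ℝ → Euc n} (hy : Continuous y) (h : ℝ) :
    Continuous fun s => history r y (s - h) :=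
  (continuous_history hy).comp (continuous_id.sub continuous_const)

theorem continuous_lagStep (hF : RegularRHS r n t₀ F) (x₀ : Hist r n) (h : ℝ) {y : ℝ → Euc n}
    (hy : Continuous y) : Continuous (lagStep F t₀ x₀ h y) :=
  (uniformContinuous_initExtend t₀ x₀).continuous.add
    (intervalIntegral.continuous_primitive
      (fun a b => hF.intervalIntegrable (continuous_shift hy h) a b) t₀)

theorem lagStep_congr (x₀ : Hist r n) {h c : ℝ} {y z : ℝ → Euc n} (hc : t₀ ≤ c + h)
    (hyz : ∀ s ≤ c, y s = z s) : ∀ t ≤ c + h, lagStep F t₀ x₀ h y t = lagStep F t₀ x₀ h z t := by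
  intro t ht
  simp only [lagStep]
  congr 1
  refine intervalIntegral.integral_congr_ae (Eventually.of_forall fun s hs => ?_)
  have hs' : s ≤ c + h := hs.2.trans (max_le hc ht)
  rw [history_congr fun q hq => hyz q (by linarith [hq.2])]

/-- Solutions of the equation with time lag `h`, by the method of steps. -/
theorem exists_lagStep_fixed (hF : RegularRHS r n t₀ F) (x₀ : Hist r n) {h : ℝ} (hh : 0 < h) :
    ∃ y : ℝ → Euc n, Continuous y ∧ ∀ t, y t = lagStep F t₀ x₀ h y t := by
  -- The lagged operator at time `t` sees its argument only up to `t - h`, so each iteration fixes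
  -- the values on a further interval of length `h`.
  let Y : ℕ → ℝ → Euc n := fun j => (lagStep F t₀ x₀ h)^[j] (initExtend t₀ x₀)
  have hYs : ∀ j, Y (j + 1) = lagStep F t₀ x₀ h (Y j) := fun j =>
    Function.iterate_succ_apply' _ _ _
  have hYc : ∀ j, Continuous (Y j) := by
    intro j
    induction j with
    | zero => exact (uniformContinuous_initExtend t₀ x₀).continuous
    | succ j ih => rw [hYs]; exact hF.continuous_lagStep x₀ h ih
  have hstep : ∀ j : ℕ, ∀ t ≤ t₀ + j * h, Y (j + 1) t = Y j t := by
    intro j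
    induction j with
    | zero =>
      intro t ht
      rw [hYs]
      simp only [Nat.cast_zero, zero_mul, add_zero] at ht
      simp only [lagStep, hF.integral_eq_zero _ ht, add_zero]
      rfl
    | succ j ih =>
      intro t ht
      have hj : 0 ≤ (j : ℝ) * h := mul_nonneg j.cast_nonneg hh.le
      rw [hYs (j + 1), hYs j]
      push_cast at ht
      exact lagStep_congr x₀ (h := h) (c := t₀ + j * h) (by linarith)
        (fun s hs => (congrFun (hYs j) s).symm.trans (ih s hs)) t (by linarith)
  have hchain : ∀ N j : ℕ, N ≤ j → ∀ t ≤ t₀ + N * h, Y j t = Y N t := by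
    intro N j hNj
    induction j, hNj using Nat.le_induction with
    | base => intro t _; rfl
    | succ j hj ih =>
      intro t ht
      rw [hstep j t, ih t ht]
      have : (N : ℝ) * h ≤ j * h := mul_le_mul_of_nonneg_right (by exact_mod_cast hj) hh.le
      linarith
  -- An index from which the iterates no longer change at time `t`.
  let N : ℝ → ℕ := fun t => ⌈(t - t₀) / h⌉₊
  have hN : ∀ t, t ≤ t₀ + N t * h := by
    intro t
    have := Nat.le_ceil ((t - t₀) / h)
    rw [div_le_iff₀ hh] at this
    simp only [N]; linarith
  let y : ℝ → Euc n := fun t => Y (N t) t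
  have hy : ∀ j : ℕ, ∀ t ≤ t₀ + j * h, y t = Y j t := by
    intro j t ht
    refine (hchain (N t) j ?_ t (hN t)).symm
    refine Nat.ceil_le.2 ?_
    rw [div_le_iff₀ hh]; linarith
  have hlocal : ∀ t : ℝ, ∃ j : ℕ, t < t₀ + j * h := by
    intro t
    obtain ⟨j, hj⟩ := exists_nat_gt ((t - t₀) / h)
    rw [div_lt_iff₀ hh] at hj
    exact ⟨j, by linarith⟩
  refine ⟨y, ?_, fun t => ?_⟩
  · refine continuous_iff_continuousAt.2 fun t => ?_
    obtain ⟨j, hj⟩ := hlocal t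
    refine (hYc j).continuousAt.congr ?_
    filter_upwards [Iio_mem_nhds hj] with s hs using (hy j s (le_of_lt hs)).symm
  · obtain ⟨j, hj⟩ := hlocal t
    have h1 : y t = Y (j + 1) t := by
      refine hy (j + 1) t ?_
      push_cast; linarith
    rw [h1, hYs]
    have h0 : 0 ≤ (j : ℝ) * h := mul_nonneg j.cast_nonneg hh.le
    exact (lagStep_congr x₀ (h := h) (c := t₀ + j * h) (by linarith) (hy j) t (by linarith)).symm

theorem dist_integral_le (hF : RegularRHS r n t₀ F) {X : ℝ → Hist r n} (hX : Continuous X)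
    {T m : ℝ} (hm : ∀ s ≤ T, ∀ X, ‖F s X‖ ≤ m) {s t : ℝ} (hs : s ≤ T) (ht : t ≤ T) :
    ‖(∫ q in t₀..s, F q (X q)) - ∫ q in t₀..t, F q (X q)‖ ≤ m * |s - t| := by
  rw [intervalIntegral.integral_interval_sub_left (hF.intervalIntegrable hX _ _)
    (hF.intervalIntegrable hX _ _)]
  exact intervalIntegral.norm_integral_le_of_norm_le_const fun q hq =>
    hm q (hq.2.trans (max_le ht hs)) _

/-- The bound on `F` makes the modulus of continuity independent of the lag, which controls `y (s -
h) - y s` uniformly. -/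
theorem exists_modulus (hF : RegularRHS r n t₀ F) (x₀ : Hist r n) (T : ℝ) {η : ℝ} (hη : 0 < η) :
    ∃ δ > 0, ∀ h y, Continuous y → (∀ t, y t = lagStep F t₀ x₀ h y t) →
      ∀ s ≤ T, ∀ t ≤ T, |s - t| < δ → ‖y s - y t‖ ≤ η := by
  obtain ⟨m, hm0, hm⟩ := hF.bdd T
  obtain ⟨δ, hδ, hu⟩ := Metric.uniformContinuous_iff.1 (uniformContinuous_initExtend t₀ x₀) (η / 2)
    (by linarith)
  refine ⟨min δ (η / (2 * (m + 1))), by positivity, fun h y hy hfix s hs t ht hst => ?_⟩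
  have h1 := (hu (a := s) (b := t) (by rw [Real.dist_eq]; exact hst.trans_le (min_le_left _ _))).le
  have h2 := hF.dist_integral_le (continuous_shift hy h) hm hs ht
  have h3 : m * |s - t| ≤ η / 2 := by
    have h4 := (hst.trans_le (min_le_right _ _)).le
    rw [le_div_iff₀ (by positivity)] at h4
    nlinarith [abs_nonneg (s - t)]
  rw [hfix s, hfix t]
  simp only [lagStep]
  rw [add_sub_add_comm]
  rw [dist_eq_norm] at h1
  exact (norm_add_le _ _).trans (by linarith)

theorem absolutelyContinuousOnInterval_of_eq (hF : RegularRHS r n t₀ F) {x₀ : Hist r n}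
    {X : ℝ → Hist r n} (hX : Continuous X) {y : ℝ → Euc n}
    (hy : ∀ t, y t = initExtend t₀ x₀ t + ∫ s in t₀..t, F s (X s)) {T : ℝ} (hT : t₀ ≤ T) :
    AbsolutelyContinuousOnInterval y t₀ T := by
  obtain ⟨m, hm0, hm⟩ := hF.bdd T
  refine LipschitzOnWith.absolutelyContinuousOnInterval (K := ⟨m, hm0⟩)
    (LipschitzOnWith.of_dist_le_mul fun s hs t ht => ?_)
  rw [uIcc_of_le hT] at hs ht
  rw [hy s, hy t, initExtend_of_le x₀ hs.1, initExtend_of_le x₀ ht.1, dist_add_left, dist_eq_norm,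
    Real.dist_eq]
  exact hF.dist_integral_le hX hm hs.2 ht.2

theorem ae_hasDerivAt_of_eq (hF : RegularRHS r n t₀ F) {x₀ : Hist r n}
    {X : ℝ → Hist r n} (hX : Continuous X) {y : ℝ → Euc n}
    (hy : ∀ t, y t = initExtend t₀ x₀ t + ∫ s in t₀..t, F s (X s)) :
    ∀ᵐ t, t₀ < t → HasDerivAt y (F t (X t)) t := by
  filter_upwards [LocallyIntegrable.ae_hasDerivAt_integral (hF.locallyIntegrable hX)] with t ht h0
  refine ((ht t₀).const_add (x₀ (histZero r))).congr_of_eventuallyEq ?_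
  filter_upwards [Ioi_mem_nhds h0] with s hs
  rw [hy s, initExtend_of_le x₀ (le_of_lt hs)]

theorem eq_initExtend (hF : RegularRHS r n t₀ F) {x₀ : Hist r n} {X : ℝ → Hist r n}
    {y : ℝ → Euc n} (hy : ∀ t, y t = initExtend t₀ x₀ t + ∫ s in t₀..t, F s (X s)) {t : ℝ}
    (ht : t ≤ t₀) : y t = initExtend t₀ x₀ t := by
  rw [hy, hF.integral_eq_zero _ ht, add_zero]

/-- Solutions with small time lags are uniformly close to each other. -/
theorem exists_lag_norm_sub_le (hF : RegularRHS r n t₀ F) (x₀ : Hist r n) {T : ℝ} (hT : t₀ ≤ T)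
    {ε : ℝ} (hε : 0 < ε) :
    ∃ δ > 0, ∀ h h' y y', 0 < h → h < δ → 0 < h' → h' < δ → Continuous y → Continuous y' →
      (∀ t, y t = lagStep F t₀ x₀ h y t) → (∀ t, y' t = lagStep F t₀ x₀ h' y' t) →
      ∀ t ≤ T, ‖y t - y' t‖ ≤ ε := by
  obtain ⟨m, hm0, hm⟩ := hF.bdd T
  obtain ⟨L, hL0, hL⟩ := hF.lip T
  -- With `η ≤ 1`, the history difference costs `L * (b + 2 * η) ^ 2 ≤ 2 * L * b ^ 2 + 8 * L * η`
  -- and the shift of the left factor costs `4 * m * η`; the `1` keeps the constant positive. `A`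
  -- also contains the factor from the energy estimate.
  set A := (8 * L + 4 * m + 1) * (2 * Real.exp ((2 * (2 * L) + 1) * (T - t₀))) with hA
  have hApos : 0 < A := by positivity
  set η := min 1 (ε ^ 2 / A) with hη
  have hη0 : 0 < η := by positivity
  have hη1 : η ≤ 1 := min_le_left _ _
  have hηA : η * A ≤ ε ^ 2 := by
    have := min_le_right 1 (ε ^ 2 / A)
    rwa [← hη, le_div_iff₀ hApos] at this
  obtain ⟨δ, hδ, hmod⟩ := hF.exists_modulus x₀ T hη0
  refine ⟨δ, hδ, fun h h' y y' hh hhδ hh' hhδ' hy hy' hfix hfix' => ?_⟩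
  have hX := continuous_shift (r := r) hy h
  have hX' := continuous_shift (r := r) hy' h'
  have hz0 : ∀ t ≤ t₀, y t - y' t = 0 := fun t ht => by
    rw [hF.eq_initExtend hfix ht, hF.eq_initExtend hfix' ht, sub_self]
  have key := ((hF.absolutelyContinuousOnInterval_of_eq hX hfix hT).sub
    (hF.absolutelyContinuousOnInterval_of_eq hX' hfix' hT)).norm_sq_le_of_inner_le
    (K := 2 * L) (ε := (8 * L + 4 * m + 1) * η) (by positivity) (by positivity) hT
    (hz0 t₀ le_rfl) (by
      filter_upwards [hF.ae_hasDerivAt_of_eq hX hfix, hF.ae_hasDerivAt_of_eq hX' hfix'] with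
        t hd hd' ht b hb hle
      refine ⟨_, (hd ht.1).sub (hd' ht.1), ?_⟩
      have hmod1 : ∀ s ≤ T, ‖y (s - h) - y s‖ ≤ η := fun s hs =>
        hmod h y hy hfix _ (by linarith) _ hs (by
          rw [sub_sub_cancel_left, abs_neg, abs_of_pos hh]; exact hhδ)
      have hmod2 : ∀ s ≤ T, ‖y' s - y' (s - h')‖ ≤ η := fun s hs =>
        hmod h' y' hy' hfix' _ hs _ (by linarith) (by
          rw [sub_sub_cancel, abs_of_pos hh']; exact hhδ')
      have hz : ∀ s ≤ t, ‖y s - y' s‖ ≤ b := by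
        intro s hs
        rcases le_total s t₀ with hs0 | hs0
        · rw [hz0 s hs0, norm_zero]; exact hb
        · exact hle s ⟨hs0, hs⟩
      have hXX : ‖history r y (t - h) - history r y' (t - h')‖ ≤ b + 2 * η := by
        refine norm_history_sub_le hy hy' fun θ hθ => ?_
        have hs : t + θ ≤ T := by linarith [hθ.2, ht.2]
        have e1 := hmod1 (t + θ) hs
        have e2 := hmod2 (t + θ) hs
        have e3 := hz (t + θ) (by linarith [hθ.2])
        rw [show t - h + θ = t + θ - h by ring, show t - h' + θ = t + θ - h' by ring,
          show y (t + θ - h) - y' (t + θ - h') = (y (t + θ - h) - y (t + θ)) +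
            (y (t + θ) - y' (t + θ)) + (y' (t + θ) - y' (t + θ - h')) by abel]
        exact (norm_add₃_le).trans (by linarith)
      have hlip := hL t ht.2.le (history r y (t - h)) (history r y' (t - h'))
      rw [history_apply hy, history_apply hy'] at hlip
      simp only [histZero, add_zero] at hlip
      set G := F t (history r y (t - h)) - F t (history r y' (t - h')) with hG
      have hGm : ‖G‖ ≤ 2 * m := (norm_sub_le _ _).trans (by
        linarith [hm t ht.2.le (history r y (t - h)), hm t ht.2.le (history r y' (t - h'))])
      -- The one-sided condition concerns the end values of the two histories, which are taken at `t
      -- - h` and `t - h'`; the difference from time `t` is a small error against the bounded `G`.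
      have hsplit : inner ℝ (y t - y' t) G = inner ℝ (y (t - h) - y' (t - h')) G +
          inner ℝ ((y t - y (t - h)) + (y' (t - h') - y' t)) G := by
        rw [← inner_add_left]; congr 1; abel
      have herr : inner ℝ ((y t - y (t - h)) + (y' (t - h') - y' t)) G ≤ 2 * η * (2 * m) := by
        refine (real_inner_le_norm _ _).trans (mul_le_mul ?_ hGm (norm_nonneg _) (by positivity))
        have e1 := hmod1 t ht.2.le
        have e2 := hmod2 t ht.2.le
        rw [norm_sub_rev] at e1 e2
        exact (norm_add_le _ _).trans (by linarith)
      have hsq : L * ‖history r y (t - h) - history r y' (t - h')‖ ^ 2 ≤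
          L * (2 * b ^ 2 + 8 * η) := by
        refine mul_le_mul_of_nonneg_left ?_ hL0
        have := pow_le_pow_left₀ (norm_nonneg _) hXX 2
        nlinarith [sq_nonneg (b - 2 * η)]
      show inner ℝ (y t - y' t) G ≤ _
      rw [hsplit]
      nlinarith)
  intro t ht
  rcases le_total t t₀ with h0 | h0
  · rw [hz0 t h0, norm_zero]; exact hε.le
  · have := key t ⟨h0, ht⟩
    refine abs_le_of_sq_le_sq' ?_ hε.le |>.2
    refine this.trans (le_trans ?_ hηA)
    have hexp : Real.exp ((2 * (2 * L) + 1) * (t - t₀)) ≤ Real.exp ((2 * (2 * L) + 1) * (T - t₀)) := by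
      gcongr
    rw [hA]
    calc 2 * ((8 * L + 4 * m + 1) * η) * Real.exp ((2 * (2 * L) + 1) * (t - t₀))
        ≤ 2 * ((8 * L + 4 * m + 1) * η) * Real.exp ((2 * (2 * L) + 1) * (T - t₀)) := by gcongr
      _ = _ := by ring

/-- Global existence for a functional differential equation with a regular right-hand side. -/
theorem exists_solution (hF : RegularRHS r n t₀ F) (x₀ : Hist r n) :
    ∃ x : ℝ → Euc n, Continuous x ∧
      ∀ t, x t = initExtend t₀ x₀ t + ∫ s in t₀..t, F s (history r x s) := by
  have hpos : ∀ k : ℕ, (0 : ℝ) < 1 / ((k : ℝ) + 1) := fun k => by positivity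
  choose Y hYc hYfix using fun k : ℕ => hF.exists_lagStep_fixed x₀ (hpos k)
  have hlag : Tendsto (fun k : ℕ => 1 / ((k : ℝ) + 1)) atTop (𝓝 0) :=
    tendsto_one_div_add_atTop_nhds_zero_nat
  have hcauchy : ∀ T ε : ℝ, 0 < ε → ∃ N, ∀ j ≥ N, ∀ k ≥ N, ∀ t ≤ T, ‖Y j t - Y k t‖ ≤ ε := by
    intro T ε hε
    obtain ⟨δ, hδ, h⟩ := hF.exists_lag_norm_sub_le x₀ (le_max_right T t₀) hε
    obtain ⟨N, hN⟩ := eventually_atTop.1 (hlag.eventually (gt_mem_nhds hδ))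
    exact ⟨N, fun j hj k hk t ht => h _ _ _ _ (hpos j) (hN j hj) (hpos k) (hN k hk) (hYc j)
      (hYc k) (hYfix j) (hYfix k) t (ht.trans (le_max_left _ _))⟩
  have hlim : ∀ t, ∃ x, Tendsto (fun k => Y k t) atTop (𝓝 x) := by
    intro t
    refine cauchySeq_tendsto_of_complete (Metric.cauchySeq_iff'.2 fun ε hε => ?_)
    obtain ⟨N, hN⟩ := hcauchy t (ε / 2) (by linarith)
    refine ⟨N, fun j hj => ?_⟩
    rw [dist_eq_norm]
    exact (hN j hj N le_rfl t le_rfl).trans_lt (by linarith)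
  choose x hx using hlim
  have hunif : ∀ T ε : ℝ, 0 < ε → ∃ N, ∀ k ≥ N, ∀ t ≤ T, ‖Y k t - x t‖ ≤ ε := by
    intro T ε hε
    obtain ⟨N, hN⟩ := hcauchy T ε hε
    refine ⟨N, fun k hk t ht => ?_⟩
    refine le_of_tendsto (((hx t).const_sub (Y k t)).norm) ?_
    filter_upwards [eventually_ge_atTop N] with j hj using hN k hk j hj t ht
  have hxc : Continuous x := by
    refine TendstoLocallyUniformly.continuous (F := Y) (p := atTop) ?_
      (Eventually.of_forall hYc).frequently
    refine Metric.tendstoLocallyUniformly_iff.2 fun ε hε t => ?_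
    obtain ⟨N, hN⟩ := hunif (t + 1) (ε / 2) (by linarith)
    refine ⟨Iio (t + 1), Iio_mem_nhds (by linarith), ?_⟩
    filter_upwards [eventually_ge_atTop N] with k hk s hs
    rw [dist_comm, dist_eq_norm]
    exact (hN k hk s (le_of_lt hs)).trans_lt (by linarith)
  refine ⟨x, hxc, fun t => ?_⟩
  -- Uniform convergence absorbs the change of curve, continuity of histories the vanishing lag;
  -- dominated convergence then passes to the limit in the integral equation.
  have hhist : ∀ s, Tendsto (fun k : ℕ => history r (Y k) (s - 1 / ((k : ℝ) + 1))) atTop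
      (𝓝 (history r x s)) := by
    intro s
    have h1 : Tendsto (fun k : ℕ => history r x (s - 1 / ((k : ℝ) + 1))) atTop
        (𝓝 (history r x s)) := by
      refine ((continuous_history hxc).tendsto s).comp ?_
      simpa using hlag.const_sub s
    have h2 : Tendsto (fun k : ℕ => history r (Y k) (s - 1 / ((k : ℝ) + 1)) -
        history r x (s - 1 / ((k : ℝ) + 1))) atTop (𝓝 0) := by
      refine Metric.tendsto_atTop.2 fun ε hε => ?_
      obtain ⟨N, hN⟩ := hunif s (ε / 2) (by linarith)
      refine ⟨N, fun k hk => ?_⟩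
      rw [dist_zero_right]
      refine (norm_history_sub_le (hYc k) hxc fun θ hθ => hN k hk _ ?_).trans_lt
        (by linarith : ε / 2 < ε)
      linarith [hθ.2, hpos k]
    simpa using h2.add h1
  obtain ⟨m, hm0, hm⟩ := hF.bdd (max t₀ t)
  have hint : Tendsto (fun k : ℕ => ∫ s in t₀..t, F s (history r (Y k) (s - 1 / ((k : ℝ) + 1))))
      atTop (𝓝 (∫ s in t₀..t, F s (history r x s))) := by
    refine intervalIntegral.tendsto_integral_filter_of_dominated_convergence (fun _ => m)
      (Eventually.of_forall fun k => (hF.meas _ (continuous_shift (hYc k) _)).restrict)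
      (Eventually.of_forall fun k => Eventually.of_forall fun s hs => hm s hs.2 _) (by simp)
      (Eventually.of_forall fun s _ => ((hF.cont s).tendsto _).comp (hhist s))
  refine tendsto_nhds_unique (hx t) ?_
  have : (fun k => Y k t) = fun k : ℕ => initExtend t₀ x₀ t +
      ∫ s in t₀..t, F s (history r (Y k) (s - 1 / ((k : ℝ) + 1))) := by
    ext1 k; exact hYfix k t
  rw [this]
  exact hint.const_add _

end RegularRHS

namespace RFDESystem

variable {l m n k₁ k₂ : ℕ} {S : RFDESystem l m n k₁ k₂}

/-! ### Uniform bounds on bounded sets -/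

theorem Standing.exists_lip (hS : S.Standing) (T B : ℝ) :
    ∃ L, 0 ≤ L ∧ ∀ t ∈ Icc 0 T, ∀ X Y : Hist S.r n, ‖X‖ ≤ B → ‖Y‖ ≤ B → ∀ u ∈ S.U, ‖u‖ ≤ B →
      ∀ v ∈ S.S₂, ‖v‖ ≤ B → ∀ d ∈ S.D,
      inner ℝ (X (histZero S.r) - Y (histZero S.r)) (S.f t d X u v - S.f t d Y u v)
        ≤ L * ‖X - Y‖ ^ 2 := by
  obtain ⟨L, hL, h⟩ := hS.f_lip (Icc 0 T)
    ((univ ×ˢ S.U ×ˢ S.S₂) ∩ Metric.closedBall 0 B) Icc_subset_Ici_self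
    (Metric.isBounded_Icc 0 T) inter_subset_left
    (Metric.isBounded_closedBall.subset inter_subset_right)
  refine ⟨L, hL, fun t ht X Y hX hY u hu hu' v hv hv' d hd => ?_⟩
  have mem : ∀ Z : Hist S.r n, ‖Z‖ ≤ B → ((Z, u, v) : Hist S.r n × Euc m × Euc k₂) ∈
      (univ ×ˢ S.U ×ˢ S.S₂) ∩ Metric.closedBall 0 B := fun Z hZ =>
    ⟨⟨mem_univ _, hu, hv⟩, by
      rw [mem_closedBall_zero_iff, Prod.norm_def, Prod.norm_def]
      exact max_le hZ (max_le hu' hv')⟩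
  exact h t ht X Y u v (mem X hX) (mem Y hY) d hd

theorem Standing.exists_bound (hS : S.Standing) (T B : ℝ) :
    ∃ K, 0 ≤ K ∧ ∀ t ∈ Icc 0 T, ∀ X : Hist S.r n, ‖X‖ ≤ B → ∀ u ∈ S.U, ‖u‖ ≤ B →
      ∀ v ∈ S.S₂, ‖v‖ ≤ B → ∀ d ∈ S.D, ‖S.f t d X u v‖ ≤ K := by
  obtain ⟨a, β, ha, hβ, h⟩ := hS.f_growth
  obtain ⟨b, hb⟩ := isCompact_Icc.bddAbove_image (hβ.1.mono (Icc_subset_Ici_self : Icc 0 T ⊆ Ici 0))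
  refine ⟨3 * a (|b| * |B|), mul_nonneg (by norm_num) (ha.1.nonneg (by positivity)),
    fun t ht X hX u hu hu' v hv hv' d hd => (h t ht.1 X u hu v hv d hd).trans ?_⟩
  have hβt : β t ≤ |b| := (hb (mem_image_of_mem _ ht)).trans (le_abs_self b)
  have hβ0 := (hβ.2 t ht.1).le
  have key : ∀ y : ℝ, 0 ≤ y → y ≤ B → a (β t * y) ≤ a (|b| * |B|) := fun y hy hyB =>
    ha.1.mono (by positivity) (mul_le_mul hβt (hyB.trans (le_abs_self B)) hy (abs_nonneg b))
  have h1 := key _ (norm_nonneg X) hX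
  have h2 := key _ (norm_nonneg u) hu'
  have h3 := key _ (norm_nonneg v) hv'
  linarith

theorem Admissible.exists_bound {t₀ : ℝ} {v : ℝ → Euc k₂} {u : ℝ → Euc m} {d : ℝ → Euc l}
    (h : S.Admissible t₀ v u d) (T : ℝ) : ∃ B, ∀ t ∈ Icc 0 T, ‖v t‖ ≤ B ∧ ‖u t‖ ≤ B := by
  obtain ⟨B₁, h₁⟩ := h.2.1.2.2 T
  obtain ⟨B₂, h₂⟩ := h.2.2.1.2.2 T
  exact ⟨max B₁ B₂, fun t ht => ⟨(h₁ t ht).trans (le_max_left _ _),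
    (h₂ t ht).trans (le_max_right _ _)⟩⟩

/-! ### Uniqueness -/

/-- On a compact interval both solutions and the inputs are bounded, so one constant `L` applies and
the difference obeys the energy estimate for every `ε > 0`; then `ε → 0`. -/
theorem IsSolution.unique (hS : S.Standing) {t₀ : ℝ} {T T' : EReal} {x₀ : Hist S.r n}
    {v : ℝ → Euc k₂} {u : ℝ → Euc m} {d : ℝ → Euc l} {x y : ℝ → Euc n}
    (hadm : S.Admissible t₀ v u d) (hx : S.IsSolution t₀ T x₀ v u d x)
    (hy : S.IsSolution t₀ T' x₀ v u d y) {t : ℝ} (h0 : t₀ - S.r ≤ t) (ht : (t : EReal) < T)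
    (ht' : (t : EReal) < T') : x t = y t := by
  have hz0 : ∀ s ∈ Icc (t₀ - S.r) t₀, x s = y s := fun s hs => by
    rw [hx.apply_init hs, hy.apply_init hs]
  rcases le_total t t₀ with htt | htt
  · exact hz0 t ⟨h0, htt⟩
  have hr : (0 : ℝ) ≤ S.r := S.r.2
  have ht₀ := hadm.1
  have hxc := hx.continuousOn_Icc le_rfl ht
  have hyc := hy.continuousOn_Icc le_rfl ht'
  obtain ⟨B₁, hB₁⟩ := isCompact_Icc.exists_bound_of_continuousOn hxc
  obtain ⟨B₂, hB₂⟩ := isCompact_Icc.exists_bound_of_continuousOn hyc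
  obtain ⟨B₃, hB₃⟩ := hadm.exists_bound t
  obtain ⟨L, hL, hlip⟩ := hS.exists_lip t (max B₁ (max B₂ B₃))
  have key : ∀ ε : ℝ, 0 < ε →
      ‖x t - y t‖ ^ 2 ≤ 2 * ε * Real.exp ((2 * L + 1) * (t - t₀)) := by
    intro ε hε
    refine ((hx.absolutelyContinuousOnInterval htt ht).sub
      (hy.absolutelyContinuousOnInterval htt ht')).norm_sq_le_of_inner_le hL hε htt
      (sub_eq_zero.2 (hz0 t₀ ⟨by linarith, le_rfl⟩)) ?_ t ⟨htt, le_rfl⟩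
    filter_upwards [hx.ode, hy.ode] with s hsx hsy hs b hb hle
    have hst : (s : EReal) < t := EReal.coe_lt_coe_iff.2 hs.2
    refine ⟨_, (hsx hs.1.le (hst.trans ht)).sub (hsy hs.1.le (hst.trans ht')), ?_⟩
    have hsub : Icc (s - S.r) s ⊆ Icc (t₀ - S.r) t :=
      Icc_subset_Icc (by linarith [hs.1]) hs.2.le
    have hxs := hxc.mono hsub
    have hys := hyc.mono hsub
    have hs0 : 0 ≤ s := ht₀.trans hs.1.le
    have hin := hB₃ s ⟨hs0, hs.2.le⟩
    have := hlip s ⟨hs0, hs.2.le⟩ (history S.r x s) (history S.r y s)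
      ((norm_history_le hxs fun q hq => hB₁ q (hsub hq)).trans (le_max_left _ _))
      ((norm_history_le hys fun q hq => hB₂ q (hsub hq)).trans
        ((le_max_left _ _).trans (le_max_right _ _)))
      (u s) (hadm.2.2.1.1 s hs0) (hin.2.trans ((le_max_right _ _).trans (le_max_right _ _)))
      (v s) (hadm.2.1.1 s hs0) (hin.1.trans ((le_max_right _ _).trans (le_max_right _ _)))
      (d s) (hadm.2.2.2.1 s hs0)
    rw [history_zero_of_continuousOn hxs, history_zero_of_continuousOn hys] at this
    have hXY : ‖history S.r x s - history S.r y s‖ ≤ b := by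
      rw [ContinuousMap.norm_le _ hb]
      intro θ
      rw [ContinuousMap.sub_apply, history_apply_of_continuousOn hxs,
        history_apply_of_continuousOn hys]
      have hθ : s + θ ∈ Icc (s - S.r) s := ⟨by linarith [θ.2.1], by linarith [θ.2.2]⟩
      rcases le_total (s + θ) t₀ with h | h
      · rw [hz0 _ ⟨(hsub hθ).1, h⟩, sub_self, norm_zero]; exact hb
      · exact hle _ ⟨h, hθ.2⟩
    have hsq := mul_le_mul_of_nonneg_left (pow_le_pow_left₀ (norm_nonneg _) hXY 2) hL
    show inner ℝ (x s - y s) _ ≤ _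
    linarith
  have hlim : Tendsto (fun ε : ℝ => 2 * ε * Real.exp ((2 * L + 1) * (t - t₀))) (𝓝[>] 0) (𝓝 0) := by
    have : Tendsto (fun ε : ℝ => 2 * ε * Real.exp ((2 * L + 1) * (t - t₀))) (𝓝 0)
        (𝓝 (2 * 0 * Real.exp ((2 * L + 1) * (t - t₀)))) := Continuous.tendsto (by fun_prop) 0
    rw [mul_zero, zero_mul] at this
    exact this.mono_left nhdsWithin_le_nhds
  have hle : ‖x t - y t‖ ^ 2 ≤ 0 := ge_of_tendsto hlim
    (by filter_upwards [self_mem_nhdsWithin] with ε hε using key ε hε)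
  have : ‖x t - y t‖ = 0 := by
    have := sq_nonneg ‖x t - y t‖
    exact pow_eq_zero_iff (n := 2) (by norm_num) |>.1 (le_antisymm hle this)
  exact sub_eq_zero.1 (norm_eq_zero.1 this)

end RFDESystem

/-! ### Truncation of the right-hand side -/

/-- A Lipschitz function equal to `1` on the ball of radius `M` and to `0` off the ball of
radius `2 M`. -/
noncomputable def cutoff {E : Type*} [NormedAddCommGroup E] (M : ℝ) (X : E) : ℝ :=
  max 0 (min 1 (2 - ‖X‖ / M))

section cutoff

variable {E : Type*} [NormedAddCommGroup E] {M : ℝ} {X Y : E}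

theorem cutoff_nonneg : 0 ≤ cutoff M X := le_max_left _ _

theorem cutoff_le_one : cutoff M X ≤ 1 := max_le zero_le_one (min_le_left _ _)

theorem cutoff_eq_one (hM : 0 < M) (h : ‖X‖ ≤ M) : cutoff M X = 1 := by
  have : ‖X‖ / M ≤ 1 := (div_le_one hM).2 h
  rw [cutoff, min_eq_left (by linarith), max_eq_right zero_le_one]

theorem cutoff_eq_zero (hM : 0 < M) (h : 2 * M ≤ ‖X‖) : cutoff M X = 0 := by
  have : 2 ≤ ‖X‖ / M := (le_div_iff₀ hM).2 h
  rw [cutoff, max_eq_left]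
  exact (min_le_right _ _).trans (by linarith)

/-- The slope of the cutoff is `1 / M`, at most `1` when `M ≥ 1`. -/
theorem abs_cutoff_sub_le (hM : 1 ≤ M) : |cutoff M X - cutoff M Y| ≤ ‖X - Y‖ := by
  have h1 : |cutoff M X - cutoff M Y| ≤ |(2 - ‖X‖ / M) - (2 - ‖Y‖ / M)| := by
    refine (abs_max_sub_max_le_max _ _ _ _).trans ?_
    rw [sub_self, abs_zero]
    refine max_le (abs_nonneg _) ((abs_min_sub_min_le_max _ _ _ _).trans ?_)
    rw [sub_self, abs_zero]
    exact max_le (abs_nonneg _) le_rfl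
  refine h1.trans ?_
  rw [show (2 - ‖X‖ / M) - (2 - ‖Y‖ / M) = (‖Y‖ - ‖X‖) / M by ring, abs_div,
    abs_of_pos (by linarith : 0 < M)]
  refine (div_le_self (abs_nonneg _) hM).trans ?_
  rw [abs_sub_comm]
  exact abs_norm_sub_norm_le X Y

end cutoff

namespace RFDESystem

variable {l m n k₁ k₂ : ℕ} {S : RFDESystem l m n k₁ k₂}

/-- The right-hand side with inputs inserted, switched off before `t₀` and for large states. -/
noncomputable def truncated (S : RFDESystem l m n k₁ k₂) (t₀ : ℝ) (M : ℝ → ℝ) (v : ℝ → Euc k₂)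
    (u : ℝ → Euc m) (d : ℝ → Euc l) (s : ℝ) : Hist S.r n → Euc n :=
  (Ici t₀).indicator (fun s X => cutoff (M s) X • S.f s (d s) X (u s) (v s)) s

theorem truncated_of_le {t₀ : ℝ} {M : ℝ → ℝ} {v : ℝ → Euc k₂} {u : ℝ → Euc m} {d : ℝ → Euc l}
    {s : ℝ} (hs : t₀ ≤ s) (X : Hist S.r n) :
    S.truncated t₀ M v u d s X = cutoff (M s) X • S.f s (d s) X (u s) (v s) := by
  rw [truncated, indicator_of_mem (mem_Ici.2 hs)]

theorem truncated_of_lt {t₀ : ℝ} {M : ℝ → ℝ} {v : ℝ → Euc k₂} {u : ℝ → Euc m} {d : ℝ → Euc l}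
    {s : ℝ} (hs : s < t₀) (X : Hist S.r n) : S.truncated t₀ M v u d s X = 0 := by
  rw [truncated, indicator_of_notMem (by simpa using hs)]; rfl

/-- The right-hand side is measurable along continuous curves of histories. -/
theorem Standing.aemeasurable_rhs (hS : S.Standing) {t₀ : ℝ} {v : ℝ → Euc k₂} {u : ℝ → Euc m}
    {d : ℝ → Euc l} (hadm : S.Admissible t₀ v u d) {X : ℝ → Hist S.r n} (hX : Continuous X) :
    AEMeasurable (fun s => S.f s (d s) (X s) (u s) (v s)) (volume.restrict (Ici 0)) := by
  let _ : MeasurableSpace (Hist S.r n) := borel _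
  have : BorelSpace (Hist S.r n) := ⟨rfl⟩
  obtain ⟨A, _, hA, hc⟩ := hS.f_time.1
  have hAc : A.Countable := by
    rcases hA with h | ⟨τ, _, _, _, rfl⟩
    · exact h.countable
    · exact countable_range τ
  set E := (Ici 0 \ A) ×ˢ (univ : Set (Hist S.r n)) ×ˢ S.U ×ˢ S.S₂ ×ˢ S.D with hE
  -- A point outside the null set `A` supplies a default value, so that `g'` takes values in `E` at
  -- every time and the continuous restriction to `E` can be composed with it.
  obtain ⟨s₀, hs₀⟩ : (Ici (0 : ℝ) \ A).Nonempty := by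
    by_contra hcon
    have h1 : Ici (0 : ℝ) ⊆ A := sdiff_eq_empty.1 (not_nonempty_iff_eq_empty.1 hcon)
    have h2 := (hAc.mono h1).measure_zero volume
    simp at h2
  obtain ⟨d₀, hd₀⟩ := hS.D_nonempty
  let g : ℝ → ℝ × Hist S.r n × Euc m × Euc k₂ × Euc l := fun s => (s, X s, u s, v s, d s)
  have hg : AEMeasurable g (volume.restrict (Ici 0)) :=
    aemeasurable_id.prodMk (hX.measurable.aemeasurable.prodMk
      (hadm.2.2.1.2.1.prodMk (hadm.2.1.2.1.prodMk hadm.2.2.2.2.1)))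
  classical
  let g' : ℝ → ℝ × Hist S.r n × Euc m × Euc k₂ × Euc l := fun s =>
    if s ∈ Ici (0 : ℝ) \ A then g s else (s₀, 0, 0, 0, d₀)
  have hgg' : g =ᵐ[volume.restrict (Ici 0)] g' := by
    filter_upwards [ae_restrict_mem measurableSet_Ici,
      ae_restrict_of_ae (hAc.ae_notMem volume)] with s h0 hsA
    simp only [g']
    rw [if_pos ⟨h0, hsA⟩]
  have hg'E : ∀ s, g' s ∈ E := by
    intro s
    by_cases h : s ∈ Ici (0 : ℝ) \ A
    · simp only [g', if_pos h]
      exact ⟨h, mem_univ _, hadm.2.2.1.1 s h.1, hadm.2.1.1 s h.1, hadm.2.2.2.1 s h.1⟩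
    · simp only [g', if_neg h]
      exact ⟨hs₀, mem_univ _, hS.zero_mem_U, hS.zero_mem_S₂, hd₀⟩
  have hmeas := (hc.domRestrict.measurable).comp_aemeasurable
    (AEMeasurable.subtype_mk (hfs := hg'E) (hg.congr hgg'))
  refine hmeas.congr ?_
  filter_upwards [hgg'] with s hs
  simp only [Function.comp_apply, domRestrict_apply, val_codRestrict_apply, ← hs]
  rfl

/-- Where the cutoff is nonzero, states and inputs are bounded on bounded time intervals, so `f` is
bounded there. Since the cutoff is nonnegative, multiplying by it preserves the one-sided estimate.
-/
theorem Standing.regularRHS_truncated (hS : S.Standing) {t₀ : ℝ} {v : ℝ → Euc k₂} {u : ℝ → Euc m}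
    {d : ℝ → Euc l} (hadm : S.Admissible t₀ v u d) {M : ℝ → ℝ} (hM : Monotone M)
    (hM1 : ∀ t, 1 ≤ M t) : RegularRHS S.r n t₀ (S.truncated t₀ M v u d) := by
  have ht₀ := hadm.1
  have hM0 : ∀ t, 0 < M t := fun t => one_pos.trans_le (hM1 t)
  have bound : ∀ T, ∃ B, ∀ t ∈ Icc 0 T, 2 * M t ≤ B ∧ ‖v t‖ ≤ B ∧ ‖u t‖ ≤ B := by
    intro T
    obtain ⟨B, hB⟩ := hadm.exists_bound T
    exact ⟨max (2 * M T) B, fun t ht => ⟨by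
      have := hM ht.2
      exact le_max_of_le_left (by linarith), (hB t ht).1.trans (le_max_right _ _),
      (hB t ht).2.trans (le_max_right _ _)⟩⟩
  have lt_of_cutoff_ne : ∀ {s} {X : Hist S.r n}, cutoff (M s) X ≠ 0 → ‖X‖ ≤ 2 * M s := by
    intro s X h
    by_contra hcon
    exact h (cutoff_eq_zero (hM0 s) (not_le.1 hcon).le)
  refine ⟨fun X hX => ?_, fun s hs X => truncated_of_lt hs X, fun s => ?_, fun T => ?_, fun T => ?_⟩
  · have h1 : AEMeasurable (fun s => cutoff (M s) (X s) • S.f s (d s) (X s) (u s) (v s))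
        (volume.restrict (Ici t₀)) := by
      have h2 : Measurable fun s => ‖X s‖ := hX.norm.measurable
      have h3 : Measurable fun s => cutoff (M s) (X s) := measurable_const.max
        (measurable_const.min (measurable_const.sub (h2.div hM.measurable)))
      exact h3.aemeasurable.smul ((hS.aemeasurable_rhs hadm hX).mono_measure
        (Measure.restrict_mono (Ici_subset_Ici.2 ht₀) le_rfl))
    refine ((aestronglyMeasurable_indicator_iff measurableSet_Ici).2 h1.aestronglyMeasurable).congr
      (Eventually.of_forall fun s => ?_)
    by_cases hs : t₀ ≤ s
    · rw [indicator_of_mem (mem_Ici.2 hs)]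
      exact (truncated_of_le hs _).symm
    · rw [indicator_of_notMem (by simpa using hs)]
      exact (truncated_of_lt (not_le.1 hs) _).symm
  · by_cases hs : t₀ ≤ s
    · have h1 : Continuous fun X : Hist S.r n => S.f s (d s) X (u s) (v s) :=
        (hS.f_cont s (ht₀.trans hs)).comp_continuous
          (f := fun X : Hist S.r n => (X, u s, v s, d s)) (by fun_prop)
          fun X => ⟨mem_univ _, hadm.2.2.1.1 s (ht₀.trans hs), hadm.2.1.1 s (ht₀.trans hs),
            hadm.2.2.2.1 s (ht₀.trans hs)⟩
      have h2 : Continuous fun X : Hist S.r n => cutoff (M s) X := by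
        unfold cutoff
        exact continuous_const.max (continuous_const.min
          (continuous_const.sub (continuous_norm.div_const _)))
      exact (h2.smul h1).congr fun X => (truncated_of_le hs X).symm
    · exact continuous_const.congr fun X => (truncated_of_lt (not_le.1 hs) X).symm
  · obtain ⟨B, hB⟩ := bound T
    obtain ⟨K, hK0, hK⟩ := hS.exists_bound T B
    refine ⟨K, hK0, fun s hsT X => ?_⟩
    by_cases hs : t₀ ≤ s
    · rw [truncated_of_le hs]
      by_cases hX : cutoff (M s) X = 0
      · rw [hX, zero_smul, norm_zero]; exact hK0
      · have hs0 := ht₀.trans hs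
        have hBs := hB s ⟨hs0, hsT⟩
        rw [norm_smul, Real.norm_eq_abs, abs_of_nonneg cutoff_nonneg]
        exact (mul_le_of_le_one_left (norm_nonneg _) cutoff_le_one).trans
          (hK s ⟨hs0, hsT⟩ X ((lt_of_cutoff_ne hX).trans hBs.1) _ (hadm.2.2.1.1 s hs0) hBs.2.2 _
            (hadm.2.1.1 s hs0) hBs.2.1 _ (hadm.2.2.2.1 s hs0))
    · rw [truncated_of_lt (not_le.1 hs), norm_zero]; exact hK0
  · obtain ⟨B, hB⟩ := bound T
    obtain ⟨K, hK0, hK⟩ := hS.exists_bound T B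
    obtain ⟨L, hL0, hL⟩ := hS.exists_lip T B
    -- `L` comes from the increment of `f`, and `K`, the bound on `f`, from the increment of the
    -- cutoff, which is Lipschitz with constant `1`.
    refine ⟨L + K, by positivity, fun s hsT => ?_⟩
    by_cases hs : t₀ ≤ s
    swap
    · intro X Y
      rw [truncated_of_lt (not_le.1 hs), truncated_of_lt (not_le.1 hs), sub_self, inner_zero_right]
      positivity
    have hs0 := ht₀.trans hs
    have hBs := hB s ⟨hs0, hsT⟩
    have hfK : ∀ X : Hist S.r n, ‖X‖ ≤ 2 * M s → ‖S.f s (d s) X (u s) (v s)‖ ≤ K := fun X hX =>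
      hK s ⟨hs0, hsT⟩ X (hX.trans hBs.1) _ (hadm.2.2.1.1 s hs0) hBs.2.2 _ (hadm.2.1.1 s hs0)
        hBs.2.1 _ (hadm.2.2.2.1 s hs0)
    -- the estimate when `Y` is not too large
    have key : ∀ X Y : Hist S.r n, ‖Y‖ ≤ 2 * M s →
        inner ℝ (X (histZero S.r) - Y (histZero S.r))
          (S.truncated t₀ M v u d s X - S.truncated t₀ M v u d s Y) ≤ (L + K) * ‖X - Y‖ ^ 2 := by
      intro X Y hY
      rw [truncated_of_le hs, truncated_of_le hs]
      set z := X (histZero S.r) - Y (histZero S.r) with hz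
      set fX := S.f s (d s) X (u s) (v s) with hfX
      set fY := S.f s (d s) Y (u s) (v s) with hfY
      have hzn : ‖z‖ ≤ ‖X - Y‖ := by
        have := ContinuousMap.norm_coe_le_norm (X - Y) (histZero S.r)
        rwa [ContinuousMap.sub_apply] at this
      have hsplit : inner ℝ z (cutoff (M s) X • fX - cutoff (M s) Y • fY) =
          cutoff (M s) X * inner ℝ z (fX - fY) +
            (cutoff (M s) X - cutoff (M s) Y) * inner ℝ z fY := by
        simp only [inner_sub_right, inner_smul_right]; ring
      have h1 : cutoff (M s) X * inner ℝ z (fX - fY) ≤ L * ‖X - Y‖ ^ 2 := by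
        have hnn : 0 ≤ L * ‖X - Y‖ ^ 2 := by positivity
        by_cases hX : cutoff (M s) X = 0
        · rw [hX, zero_mul]; exact hnn
        · have := hL s ⟨hs0, hsT⟩ X Y ((lt_of_cutoff_ne hX).trans hBs.1) (hY.trans hBs.1) _
            (hadm.2.2.1.1 s hs0) hBs.2.2 _ (hadm.2.1.1 s hs0) hBs.2.1 _ (hadm.2.2.2.1 s hs0)
          exact (mul_le_mul_of_nonneg_left this cutoff_nonneg).trans
            (mul_le_of_le_one_left hnn cutoff_le_one)
      have h2 : (cutoff (M s) X - cutoff (M s) Y) * inner ℝ z fY ≤ K * ‖X - Y‖ ^ 2 := by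
        refine (le_abs_self _).trans ?_
        rw [abs_mul]
        have h3 := abs_cutoff_sub_le (X := X) (Y := Y) (hM1 s)
        have h4 : |inner ℝ z fY| ≤ ‖X - Y‖ * K :=
          (abs_real_inner_le_norm _ _).trans
            (mul_le_mul hzn (hfK Y hY) (norm_nonneg _) (norm_nonneg _))
        exact (mul_le_mul h3 h4 (abs_nonneg _) (norm_nonneg _)).trans_eq (by ring)
      rw [hsplit]; linarith
    intro X Y
    rcases le_or_gt ‖Y‖ (2 * M s) with hY | hY
    · exact key X Y hY
    -- The inequality is symmetric in `X` and `Y`; when both are large, both truncated values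
    -- vanish.
    · rcases le_or_gt ‖X‖ (2 * M s) with hX | hX
      · have := key Y X hX
        rwa [← neg_sub (Y (histZero S.r)), ← neg_sub (S.truncated t₀ M v u d s Y), inner_neg_neg,
          norm_sub_rev X Y]
      · rw [truncated_of_le hs, truncated_of_le hs, cutoff_eq_zero (hM0 s) hX.le,
          cutoff_eq_zero (hM0 s) hY.le, zero_smul, zero_smul, sub_self, inner_zero_right]
        positivity

/-- A solution of the truncated equation is a solution as long as the truncation is inactive. -/
theorem isSolution_of_truncated {t₀ : ℝ} {v : ℝ → Euc k₂} {u : ℝ → Euc m}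
    {d : ℝ → Euc l} {M : ℝ → ℝ} (hF : RegularRHS S.r n t₀ (S.truncated t₀ M v u d))
    (hM : Monotone M) (hM1 : ∀ t, 1 ≤ M t) {x₀ : Hist S.r n} (hx₀ : ∀ t, ‖x₀‖ ≤ M t)
    {x : ℝ → Euc n} (hxc : Continuous x)
    (hx : ∀ t, x t = initExtend t₀ x₀ t + ∫ s in t₀..t, S.truncated t₀ M v u d s (history S.r x s))
    {T : EReal} (hle : ∀ t : ℝ, t₀ ≤ t → (t : EReal) < T → ‖x t‖ ≤ M t) :
    S.IsSolution t₀ T x₀ v u d x := by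
  have hX := continuous_history (r := S.r) hxc
  have hinit : ∀ θ : Icc (-(S.r : ℝ)) (0 : ℝ), x (t₀ + θ) = x₀ θ := fun θ => by
    rw [hF.eq_initExtend hx (by linarith [θ.2.2]), initExtend_add]
  refine ⟨hinit, hxc.continuousOn,
    fun c hc _ => hF.absolutelyContinuousOnInterval_of_eq hX hx hc.le, ?_⟩
  filter_upwards [hF.ae_hasDerivAt_of_eq hX hx,
    (by simp [ae_iff, measure_singleton] : ∀ᵐ t : ℝ, t ≠ t₀)] with t ht hne h0 hT
  have hlt := lt_of_le_of_ne h0 hne.symm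
  have hnorm : ‖history S.r x t‖ ≤ M t := by
    refine norm_history_le hxc.continuousOn fun s hs => ?_
    rcases le_total s t₀ with hs0 | hs0
    · have h1 := hinit ⟨s - t₀, by linarith [hs.1], by linarith⟩
      rw [add_sub_cancel] at h1
      rw [h1]
      exact (ContinuousMap.norm_coe_le_norm x₀ _).trans (hx₀ t)
    · exact (hle s hs0 ((EReal.coe_le_coe_iff.2 hs.2).trans_lt hT)).trans (hM hs.2)
  have := ht hlt
  rwa [truncated_of_le h0, cutoff_eq_one (one_pos.trans_le (hM1 t)) hnorm, one_smul] at this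

/-- Global existence from an a priori bound. -/
theorem Standing.exists_globalSolution (hS : S.Standing) {t₀ : ℝ} {v : ℝ → Euc k₂} {u : ℝ → Euc m}
    {d : ℝ → Euc l} (hadm : S.Admissible t₀ v u d) (x₀ : Hist S.r n)
    (hbound : ∀ T₀ : ℝ, ∃ b, ∀ T x, S.IsSolution t₀ T x₀ v u d x →
      ∀ s, t₀ ≤ s → s ≤ T₀ → (s : EReal) < T → ‖x s‖ ≤ b) :
    ∃ x, S.IsGlobalSolution t₀ x₀ v u d x := by
  choose b hb using hbound
  -- Summing the bounds at integer times makes the threshold monotone, and strictly larger than both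
  -- `‖x₀‖` and the a priori bound at time `t`.
  let M : ℝ → ℝ := fun t => 1 + ‖x₀‖ + ∑ k ∈ Finset.range (⌈t⌉₊ + 1), |b k|
  have hM : Monotone M := fun s t hst => by
    have : Finset.range (⌈s⌉₊ + 1) ⊆ Finset.range (⌈t⌉₊ + 1) :=
      Finset.range_subset_range.2 (Nat.succ_le_succ (Nat.ceil_mono hst))
    have := Finset.sum_le_sum_of_subset_of_nonneg this (f := fun k : ℕ => |b k|)
      fun _ _ _ => abs_nonneg _
    simp only [M]; linarith
  have hsum : ∀ t : ℝ, 0 ≤ ∑ k ∈ Finset.range (⌈t⌉₊ + 1), |b k| := fun t =>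
    Finset.sum_nonneg fun _ _ => abs_nonneg _
  have hx₀n := norm_nonneg x₀
  have hM1 : ∀ t, 1 ≤ M t := fun t => by have := hsum t; simp only [M]; linarith
  have hMx₀ : ∀ t, ‖x₀‖ < M t := fun t => by have := hsum t; simp only [M]; linarith
  have hMb : ∀ t, b ⌈t⌉₊ < M t := fun t => by
    have h1 := Finset.single_le_sum (f := fun k : ℕ => |b k|) (fun _ _ => abs_nonneg _)
      (Finset.self_mem_range_succ ⌈t⌉₊)
    have h2 := le_abs_self (b ⌈t⌉₊)
    simp only [M]; linarith
  have hF := hS.regularRHS_truncated hadm hM hM1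
  obtain ⟨x, hxc, hx⟩ := hF.exists_solution x₀
  refine ⟨x, isSolution_of_truncated hF hM hM1 (fun t => (hMx₀ t).le) hxc hx fun t ht _ => ?_⟩
  by_contra hcon
  -- the infimum of the times at which the truncation is active
  let Z : Set ℝ := {s | t₀ ≤ s ∧ M s < ‖x s‖}
  have hZne : Z.Nonempty := ⟨t, ht, not_le.1 hcon⟩
  have hZbdd : BddBelow Z := ⟨t₀, fun s hs => hs.1⟩
  set τ := sInf Z with hτ
  have ht₀τ : t₀ ≤ τ := le_csInf hZne fun s hs => hs.1
  have hbefore : ∀ s, t₀ ≤ s → s < τ → ‖x s‖ ≤ M s := fun s hs hsτ => by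
    by_contra hc
    exact absurd (csInf_le hZbdd ⟨hs, not_le.1 hc⟩) (not_le.2 hsτ)
  have hsol : S.IsSolution t₀ (τ : EReal) x₀ v u d x :=
    isSolution_of_truncated hF hM hM1 (fun t => (hMx₀ t).le) hxc hx
      fun s hs hsτ => hbefore s hs (EReal.coe_lt_coe_iff.1 hsτ)
  -- On `[t₀, τ)` the truncation is inactive, so the a priori bound holds there and passes to `τ`.
  -- Strictness then persists slightly beyond `τ`, contradicting the choice of the infimum.
  have hxτ : ‖x τ‖ < M τ := by
    rcases ht₀τ.eq_or_lt with h | h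
    · rw [← h, hsol.apply_init ⟨by linarith [S.r.2], le_rfl⟩]
      exact (ContinuousMap.norm_coe_le_norm x₀ _).trans_lt (hMx₀ t₀)
    · refine lt_of_le_of_lt ?_ (hMb τ)
      refine le_of_tendsto (hxc.norm.continuousAt.tendsto.mono_left nhdsWithin_le_nhds :
        Tendsto _ (𝓝[<] τ) _) ?_
      filter_upwards [Ioo_mem_nhdsLT h] with s hs
      exact hb _ _ x hsol s hs.1.le (hs.2.le.trans (Nat.le_ceil τ)) (EReal.coe_lt_coe_iff.2 hs.2)
  obtain ⟨ε, hε, hball⟩ := Metric.mem_nhds_iff.1 (hxc.norm.continuousAt.eventually (gt_mem_nhds hxτ))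
  obtain ⟨s, hsZ, hs⟩ := exists_lt_of_csInf_lt hZne (by linarith : sInf Z < τ + ε)
  have hsτ : τ ≤ s := csInf_le hZbdd hsZ
  have : ‖x s‖ < M τ := hball (by
    rw [Metric.mem_ball, Real.dist_eq, abs_of_nonneg (by linarith)]; linarith)
  linarith [hsZ.2, hM hsτ]

end RFDESystem

/-! ### Gains and a priori bounds for the state -/

theorem ClassKInf.classN_gain {p ζ : ℝ → ℝ} (hp : ClassKInf p) (hζ : ClassN ζ) :
    ClassN fun s => kInv p (2 * ζ s) ^ 2 := by
  refine ⟨fun s hs t ht hst => ?_, by simp [hζ.2, hp.classK_kInv.1.1]⟩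
  have h0 : 0 ≤ 2 * ζ s := by linarith [hζ.nonneg hs]
  exact pow_le_pow_left₀ (hp.kInv_nonneg h0)
    (hp.classK_kInv.mono h0 (by linarith [hζ.1 hs ht hst])) 2

theorem ClassK.classN_sq {a : ℝ → ℝ} (ha : ClassK a) : ClassN fun s => a (s ^ 2) :=
  ⟨fun s hs t _ hst => ha.mono (sq_nonneg s) (pow_le_pow_left₀ hs hst 2), by simp [ha.1.1]⟩

/-- The factor `2` reserves half of `p (√B)` for the bound on `V` and half for `R`; the square
leaves `√B` free to multiply another factor bounded by `√B`. -/
theorem ClassKInf.le_of_kInv_sq_le {p : ℝ → ℝ} (hp : ClassKInf p) {y B : ℝ} (hy : 0 ≤ y)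
    (h : kInv p (2 * y) ^ 2 ≤ B) : y ≤ p (√B) / 2 := by
  have h1 : kInv p (2 * y) ≤ √B := Real.le_sqrt_of_sq_le h
  have := (hp.kInv_le_iff (by linarith) (Real.sqrt_nonneg B)).1 h1
  linarith

namespace RFDESystem

variable {l m n k₁ k₂ : ℕ} {S : RFDESystem l m n k₁ k₂}

theorem IsSolution.lyapunov_le_max {V : ℝ → Euc n → ℝ} {a₂ a ζ ζu β δ δu ρ : ℝ → ℝ}
    (hV_nonneg : ∀ t, -(S.r : ℝ) ≤ t → ∀ x, 0 ≤ V t x)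
    (hV_lip : LocallyLipschitzOn (Ici (-(S.r : ℝ)) ×ˢ univ) (fun p : ℝ × Euc n => V p.1 p.2))
    (ha₂ : ClassKInf a₂) (ha : ClassKInf a) (ha_lt : ∀ s, 0 < s → a s < s)
    (hζ : ClassN ζ) (hβ : ClassKPlus β) (hδ : ClassKPlus δ) (hρ : PosDefFun ρ)
    (hV_upper : ∀ t, 0 ≤ t → ∀ x, V (t - S.r) x ≤ a₂ (β t * ‖x‖))
    (hV_decr : ∀ t, 0 ≤ t → ∀ x : Hist S.r n, ∀ u ∈ S.U, ∀ v ∈ S.S₂, ∀ d ∈ S.D,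
      max (ζ (δ t * ‖v‖)) (max (ζu (δu t * ‖u‖)) (a (supHist S.r V t x)))
        ≤ V t (x (histZero S.r)) →
      diniDeriv V t (x (histZero S.r)) (S.f t d x u v)
        ≤ ((-ρ (V t (x (histZero S.r))) : ℝ) : EReal))
    {t₀ : ℝ} {T : EReal} {x₀ : Hist S.r n} {v : ℝ → Euc k₂} {u : ℝ → Euc m} {d : ℝ → Euc l}
    {x : ℝ → Euc n} (hadm : S.Admissible t₀ v u d) (hx : S.IsSolution t₀ T x₀ v u d x)
    {c C : ℝ} (h0 : t₀ ≤ c) (hc : (c : EReal) < T)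
    (hv : ∀ τ ∈ Icc t₀ c, ζ (δ τ * ‖v τ‖) ≤ C) (hu : ∀ τ ∈ Icc t₀ c, ζu (δu τ * ‖u τ‖) ≤ C) :
    ∀ s ∈ Icc (t₀ - S.r) c,
      V s (x s) ≤ max (a₂ ((⨆ τ : Icc (0 : ℝ) (t₀ + S.r), β τ) * ‖x₀‖)) C :=
  (hx.razumikhinDecay hV_nonneg hV_lip hζ hδ hV_decr hadm h0 hc hv hu).le_max S.r.2 ha.1 ha_lt hρ
    (hx.lyapunov_init_le ha₂.1 hβ hV_upper hadm.1)

/-- The lower bound on the Lyapunov function turns bounds on it into bounds on the state. -/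
theorem norm_le_of_lyapunov_le {V : ℝ → Euc n → ℝ} {p μ : ℝ → ℝ} {R : ℝ} (hp : ClassKInf p)
    (hμ : ClassKPlus μ) (hV_lower : ∀ t, 0 ≤ t → ∀ x, p (μ t * ‖x‖) ≤ V (t - S.r) x + R)
    {s c q : ℝ} {x : Euc n} (hs : -(S.r : ℝ) ≤ s) (hsc : s ≤ c) (hq : 0 ≤ q)
    (hV : V s x + R ≤ p q) : ‖x‖ ≤ (⨆ τ : Icc (0 : ℝ) (c + S.r), 1 / μ τ) * q := by
  have h0 : 0 ≤ s + S.r := by linarith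
  have h1 := hV_lower (s + S.r) h0 x
  rw [add_sub_cancel_right] at h1
  have hμ0 := hμ.2 _ h0
  have h2 := (hp.1.le_iff_le (mul_nonneg hμ0.le (norm_nonneg x)) hq).1 (h1.trans hV)
  have hinv : ClassKPlus fun t => 1 / μ t :=
    ⟨continuousOn_const.div hμ.1 fun t ht => (hμ.2 t ht).ne', fun t ht => one_div_pos.2 (hμ.2 t ht)⟩
  have h3 : 1 / μ (s + S.r) ≤ _ := hinv.le_iSup h0 (by linarith : s + S.r ≤ c + S.r)
  calc ‖x‖ = 1 / μ (s + S.r) * (μ (s + S.r) * ‖x‖) := by field_simp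
    _ ≤ _ := mul_le_mul h3 h2 (mul_nonneg hμ0.le (norm_nonneg x))
        ((one_div_pos.2 hμ0).le.trans h3)

end RFDESystem

/-! ### The two conclusions -/

open RFDESystem

theorem proposition3p5 {l m n k₁ k₂ : ℕ} (S : RFDESystem l m n k₁ k₂) (hS : S.Standing)
    (V : ℝ → Euc n → ℝ)
    (hV_nonneg : ∀ t, -(S.r : ℝ) ≤ t → ∀ x, 0 ≤ V t x)
    (hV_lip : LocallyLipschitzOn (Ici (-(S.r : ℝ)) ×ˢ univ) (fun p : ℝ × Euc n => V p.1 p.2))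
    (a₂ a ζ ζu β δ δu ρ : ℝ → ℝ)
    (ha₂ : ClassKInf a₂) (ha : ClassKInf a) (ha_lt : ∀ s, 0 < s → a s < s)
    (hζ : ClassN ζ) (hζu : ClassN ζu)
    (hβ : ClassKPlus β) (hδ : ClassKPlus δ) (hδu : ClassKPlus δu)
    (hρ : PosDefFun ρ) (hρ_cont : ContinuousOn ρ (Ici 0))
    -- upper bound for `V`
    (hV_upper : ∀ t, 0 ≤ t → ∀ x, V (t - S.r) x ≤ a₂ (β t * ‖x‖))
    -- Razumikhin-type decrease condition
    (hV_decr : ∀ t, 0 ≤ t → ∀ x : Hist S.r n, ∀ u ∈ S.U, ∀ v ∈ S.S₂, ∀ d ∈ S.D,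
      max (ζ (δ t * ‖v‖)) (max (ζu (δu t * ‖u‖)) (a (supHist S.r V t x)))
        ≤ V t (x (histZero S.r)) →
      diniDeriv V t (x (histZero S.r)) (S.f t d x u v)
        ≤ ((-ρ (V t (x (histZero S.r))) : ℝ) : EReal)) :
    -- first case: `V` dominates the output, and the state estimate is known
    (∀ a₁ : ℝ → ℝ, ClassKInf a₁ →
      (∀ t, 0 ≤ t → ∀ x : Hist S.r n, a₁ ‖S.H t x‖ ≤ supHist S.r V t x) →
      (∃ μ₁ c₁ φ g₁ p₁ pu₁ : ℝ → ℝ,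
        ClassKPlus μ₁ ∧ ClassKPlus c₁ ∧ ClassKPlus φ ∧ ClassN g₁ ∧ ClassN p₁ ∧ ClassN pu₁ ∧
        ∀ t₀ x₀ v u d, S.Admissible t₀ v u d →
          ∃ x, S.IsGlobalSolution t₀ x₀ v u d x ∧
            S.StateEstimate φ μ₁ c₁ g₁ p₁ pu₁ δu t₀ x₀ v u x) →
      ∃ σ₁ : ℝ → ℝ → ℝ, ClassKL σ₁ ∧
        ∀ t₀ x₀ v u d, S.Admissible t₀ v u d →
          ∀ x, S.IsGlobalSolution t₀ x₀ v u d x →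
            S.OutputEstimate σ₁ (fun t => ⨆ τ : Icc (0 : ℝ) (t + S.r), β τ)
              (fun s => kInv a₁ (ζ s)) δ (fun s => kInv a₁ (ζu s)) δu t₀ x₀ v u x) ∧
    -- second case: `V` dominates the state
    (∀ (p μ : ℝ → ℝ) (R : ℝ), ClassKInf p → ClassKPlus μ → 0 ≤ R →
      (∀ t, 0 ≤ t → ∀ x, p (μ t * ‖x‖) ≤ V (t - S.r) x + R) →
      (∀ t, 0 ≤ t → δ t = 1) →
      -- the unique solution exists for all `t ≥ t₀`
      (∀ t₀ x₀ v u d, S.Admissible t₀ v u d →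
        ∃ x, S.IsGlobalSolution t₀ x₀ v u d x ∧
          ∀ (T : EReal) (y : ℝ → Euc n), (t₀ : EReal) < T → S.IsSolution t₀ T x₀ v u d y →
            ∀ t : ℝ, t₀ - S.r ≤ t → (t : EReal) < T → y t = x t) ∧
      ∀ φ : ℝ → ℝ, ClassKPlus φ →
        ∃ μ₁ c₁ g₁ p₁ pu₁ : ℝ → ℝ,
          ClassKPlus μ₁ ∧ ClassKPlus c₁ ∧ ClassN g₁ ∧ ClassN p₁ ∧ ClassN pu₁ ∧
          (∀ t₀ x₀ v u d, S.Admissible t₀ v u d →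
            ∀ x, S.IsGlobalSolution t₀ x₀ v u d x →
              S.StateEstimate φ μ₁ c₁ g₁ p₁ pu₁ δu t₀ x₀ v u x) ∧
          ((∃ B : ℝ, ∀ t, 0 ≤ t → φ t ≤ B) →
            (∃ L : ℝ, 0 < L ∧ ∀ t, 0 ≤ t → β t + 1 / μ t ≤ L) →
            ∃ C : ℝ, ∀ t, 0 ≤ t → c₁ t ≤ C)) := by
  refine ⟨fun a₁ ha₁ hH _ => exists_classKL_outputEstimate hV_nonneg hV_lip ha₂ ha ha_lt hζ hζu
    hβ hδ hδu hρ hρ_cont hV_upper hV_decr ha₁ hH, fun p μ R hp hμ hR hV_lower hδ1 => ⟨?_, ?_⟩⟩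
  · intro t₀ x₀ v u d hadm
    have ht₀ := hadm.1
    obtain ⟨x, hx⟩ := hS.exists_globalSolution hadm x₀ (by
      intro T₀
      obtain ⟨C₁, hC₁⟩ := bddAbove_range_gain (t₀ := t₀) (t := T₀) hadm.2.1 hζ.1 hδ.1
        (fun t ht => (hδ.2 t ht).le) ht₀
      obtain ⟨C₂, hC₂⟩ := bddAbove_range_gain (t₀ := t₀) (t := T₀) hadm.2.2.1 hζu.1 hδu.1
        (fun t ht => (hδu.2 t ht).le) ht₀
      have hM0 : 0 ≤ a₂ ((⨆ τ : Icc (0 : ℝ) (t₀ + S.r), β τ) * ‖x₀‖) :=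
        ha₂.1.nonneg (mul_nonneg ((hβ.iSup S.r.2).2 t₀ ht₀).le (norm_nonneg _))
      set W := max (a₂ ((⨆ τ : Icc (0 : ℝ) (t₀ + S.r), β τ) * ‖x₀‖)) (max C₁ C₂) + R with hW
      have hW0 : 0 ≤ W := add_nonneg (hM0.trans (le_max_left _ _)) hR
      -- Gains are bounded over all of `[t₀, T₀]`, so this bound depends neither on the solution nor
      -- on its interval of existence.
      refine ⟨(⨆ τ : Icc (0 : ℝ) (T₀ + S.r), 1 / μ τ) * kInv p W,
        fun T x hx s hs hsT₀ hsT => ?_⟩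
      have h1 := hx.lyapunov_le_max hV_nonneg hV_lip ha₂ ha ha_lt hζ hβ hδ hρ hV_upper hV_decr hadm
        hs hsT (C := max C₁ C₂)
        (fun τ hτ => (hC₁ ⟨⟨τ, hτ.1, hτ.2.trans hsT₀⟩, rfl⟩).trans (le_max_left _ _))
        (fun τ hτ => (hC₂ ⟨⟨τ, hτ.1, hτ.2.trans hsT₀⟩, rfl⟩).trans (le_max_right _ _))
        s ⟨by linarith [S.r.2], le_rfl⟩
      refine norm_le_of_lyapunov_le hp hμ hV_lower (by linarith [S.r.2]) hsT₀ (hp.kInv_nonneg hW0) ?_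
      rw [hp.apply_kInv hW0]
      linarith)
    exact ⟨x, hx, fun T y _ hy t ht htT => hy.unique hS hadm hx ht htT (EReal.coe_lt_top t)⟩
  · intro φ hφ
    have hinv : ClassKPlus fun t => 1 / μ t :=
      ⟨continuousOn_const.div hμ.1 fun t ht => (hμ.2 t ht).ne',
        fun t ht => one_div_pos.2 (hμ.2 t ht)⟩
    -- a monotone bound for `φ t / μ s`, `s ≤ t + r`
    let Q : ℝ → ℝ := fun t =>
      (⨆ τ : Icc (0 : ℝ) (t + 0), φ τ) * ⨆ τ : Icc (0 : ℝ) (t + S.r), 1 / μ τ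
    have hφs := hφ.iSup le_rfl
    have hμs := hinv.iSup S.r.2
    have hβs := hβ.iSup S.r.2
    have hQ : ClassKPlus Q := ⟨hφs.1.mul hμs.1, fun t ht => mul_pos (hφs.2 t ht) (hμs.2 t ht)⟩
    have hQ_mono : ∀ s t, 0 ≤ s → s ≤ t → Q s ≤ Q t := fun s t hs hst => by
      have h1 := hφ.iSup_mono (s := s + 0) (t := t + 0) (by linarith) (by linarith)
      have h2 := hinv.iSup_mono (s := s + S.r) (t := t + S.r) (by linarith [S.r.2]) (by linarith)
      exact mul_le_mul h1 h2 (hμs.2 s hs).le (hφs.2 t (hs.trans hst)).le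
    have hQ2 : ClassKPlus fun t => Q (2 * t) ^ 2 :=
      ⟨(hQ.1.comp (by fun_prop) fun t (ht : 0 ≤ t) => mem_Ici.2 (by linarith)).pow 2,
        fun t ht => pow_pos (hQ.2 _ (by linarith)) 2⟩
    let b : ℝ → ℝ := fun t => ⨆ τ : Icc (0 : ℝ) (t + S.r), β τ
    let P : ℝ → ℝ := fun y => kInv p (2 * y) ^ 2
    have hP_mono : ∀ y z, 0 ≤ y → y ≤ z → P y ≤ P z := fun y z hy hyz =>
      pow_le_pow_left₀ (hp.kInv_nonneg (by linarith)) (hp.classK_kInv.mono (by linarith)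
        (by linarith)) 2
    have hPc : ContinuousOn P (Ici 0) := (hp.classK_kInv.2.2.comp (by fun_prop)
      fun t (ht : 0 ≤ t) => mem_Ici.2 (by linarith)).pow 2
    have hPb : ContinuousOn (fun t => P (a₂ (b t ^ 2))) (Ici 0) :=
      hPc.comp (ha₂.1.2.2.comp (hβs.1.pow 2) fun t _ => mem_Ici.2 (sq_nonneg _))
        fun t _ => ha₂.1.nonneg (sq_nonneg _)
    -- Every entry is a square, so the right-hand side `B` of the estimate dominates the squares of
    -- both factors in `φ(t)‖T_r(t)x‖ ≤ Q t * q`, where `q = √B`.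
    refine ⟨fun t => Q (2 * t) ^ 2, fun t => max (Q (2 * t) ^ 2) (max (P (a₂ (b t ^ 2))) (P R)),
      fun s => kInv p (2 * a₂ (s ^ 2)) ^ 2, fun s => kInv p (2 * ζ s) ^ 2,
      fun s => kInv p (2 * ζu s) ^ 2, hQ2,
      ⟨ContinuousOn.sup hQ2.1 (ContinuousOn.sup hPb continuousOn_const), fun t ht => lt_max_of_lt_left (hQ2.2 t ht)⟩,
      hp.classN_gain ha₂.1.classN_sq, hp.classN_gain hζ, hp.classN_gain hζu, ?_, ?_⟩
    · intro t₀ x₀ v u d hadm x hx t ht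
      have ht₀ := hadm.1
      have h0t := ht₀.trans ht
      have hr : (0 : ℝ) ≤ S.r := S.r.2
      have hcT : (t : EReal) < ⊤ := EReal.coe_lt_top t
      set B := max (Q (2 * (t - t₀)) ^ 2)
        (max (max (Q (2 * t₀) ^ 2) (max (P (a₂ (b t₀ ^ 2))) (P R)))
        (max (kInv p (2 * a₂ (‖x₀‖ ^ 2)) ^ 2)
          (max (⨆ τ : Icc t₀ t, kInv p (2 * ζ ‖v τ‖) ^ 2)
            (⨆ τ : Icc t₀ t, kInv p (2 * ζu (δu τ * ‖u τ‖)) ^ 2)))) with hB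
      show φ t * ‖history S.r x t‖ ≤ B
      have hB1 : Q (2 * (t - t₀)) ^ 2 ≤ B := le_max_left _ _
      have hB2 : Q (2 * t₀) ^ 2 ≤ B :=
        ((le_max_left _ _).trans (le_max_left _ _)).trans (le_max_right _ _)
      have hB3 : P (a₂ (b t₀ ^ 2)) ≤ B :=
        (((le_max_left _ _).trans (le_max_right _ _)).trans (le_max_left _ _)).trans
          (le_max_right _ _)
      have hB4 : P R ≤ B :=
        (((le_max_right _ _).trans (le_max_right _ _)).trans (le_max_left _ _)).trans
          (le_max_right _ _)
      have hB5 : P (a₂ (‖x₀‖ ^ 2)) ≤ B :=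
        ((le_max_left _ _).trans (le_max_right _ _)).trans (le_max_right _ _)
      have hB6 : (⨆ τ : Icc t₀ t, kInv p (2 * ζ ‖v τ‖) ^ 2) ≤ B :=
        (((le_max_left _ _).trans (le_max_right _ _)).trans (le_max_right _ _)).trans
          (le_max_right _ _)
      have hB7 : (⨆ τ : Icc t₀ t, kInv p (2 * ζu (δu τ * ‖u τ‖)) ^ 2) ≤ B :=
        (((le_max_right _ _).trans (le_max_right _ _)).trans (le_max_right _ _)).trans
          (le_max_right _ _)
      have hB0 : 0 ≤ B := (sq_nonneg _).trans hB1
      set q := √B with hq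
      have hq0 : 0 ≤ q := Real.sqrt_nonneg B
      have hvC : ∀ τ ∈ Icc t₀ t, ζ (δ τ * ‖v τ‖) ≤ p q / 2 := by
        intro τ hτ
        rw [hδ1 τ (ht₀.trans hτ.1), one_mul]
        refine hp.le_of_kInv_sq_le (hζ.nonneg (norm_nonneg _)) (le_trans ?_ hB6)
        have hbdd := bddAbove_range_gain (t₀ := t₀) (t := t) hadm.2.1
          (hp.classN_gain hζ).1 (δ := fun _ => 1) continuousOn_const (fun _ _ => zero_le_one) ht₀
        simp only [one_mul] at hbdd
        exact le_ciSup hbdd ⟨τ, hτ⟩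
      have huC : ∀ τ ∈ Icc t₀ t, ζu (δu τ * ‖u τ‖) ≤ p q / 2 := by
        intro τ hτ
        refine hp.le_of_kInv_sq_le (hζu.nonneg (mul_nonneg (hδu.2 τ (ht₀.trans hτ.1)).le
          (norm_nonneg _))) (le_trans ?_ hB7)
        exact le_ciSup (bddAbove_range_gain (t₀ := t₀) (t := t) hadm.2.2.1
          (hp.classN_gain hζu).1 hδu.1 (fun t ht => (hδu.2 t ht).le) ht₀) ⟨τ, hτ⟩
      have hinitC : a₂ (b t₀ * ‖x₀‖) ≤ p q / 2 := by
        have hb0 : 0 ≤ b t₀ := (hβs.2 t₀ ht₀).le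
        have hn := norm_nonneg x₀
        refine hp.le_of_kInv_sq_le (ha₂.1.nonneg (mul_nonneg hb0 hn)) ?_
        -- The product `b t₀ * ‖x₀‖` is at most the square of its larger factor, which separates
        -- `t₀` from `x₀`.
        rcases le_total (b t₀) ‖x₀‖ with h | h
        · refine (hP_mono _ _ (ha₂.1.nonneg (mul_nonneg hb0 hn)) ?_).trans hB5
          exact ha₂.1.mono (mul_nonneg hb0 hn) (by nlinarith)
        · refine (hP_mono _ _ (ha₂.1.nonneg (mul_nonneg hb0 hn)) ?_).trans hB3
          exact ha₂.1.mono (mul_nonneg hb0 hn) (by nlinarith)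
      have hRC : R ≤ p q / 2 := hp.le_of_kInv_sq_le hR hB4
      have hxt : ContinuousOn x (Icc (t - S.r) t) := hx.continuousOn_Icc (by linarith) hcT
      have hnorm : ‖history S.r x t‖ ≤ (⨆ τ : Icc (0 : ℝ) (t + S.r), 1 / μ τ) * q := by
        refine norm_history_le hxt fun s hs => ?_
        have h1 := hx.lyapunov_le_max hV_nonneg hV_lip ha₂ ha ha_lt hζ hβ hδ hρ hV_upper hV_decr
          hadm ht hcT hvC huC s ⟨by linarith [hs.1], hs.2⟩
        refine norm_le_of_lyapunov_le hp hμ hV_lower (by linarith [hs.1]) hs.2 hq0 ?_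
        have h2 := max_le hinitC (le_refl (p q / 2))
        linarith [h1.trans h2]
      have hφt : φ t ≤ ⨆ τ : Icc (0 : ℝ) (t + 0), φ τ := hφ.le_iSup h0t (by linarith)
      have hQq : Q t ≤ q := by
        refine Real.le_sqrt_of_sq_le ?_
        have hQt := (hQ.2 t h0t).le
        -- Either `t ≤ 2 * t₀` or `t ≤ 2 * (t - t₀)`, and `Q` is monotone.
        rcases le_total t (2 * t₀) with h | h
        · exact (pow_le_pow_left₀ hQt (hQ_mono _ _ h0t h) 2).trans hB2
        · exact (pow_le_pow_left₀ hQt (hQ_mono _ _ h0t (by linarith)) 2).trans hB1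
      calc φ t * ‖history S.r x t‖
          ≤ (⨆ τ : Icc (0 : ℝ) (t + 0), φ τ) * ((⨆ τ : Icc (0 : ℝ) (t + S.r), 1 / μ τ) * q) :=
            mul_le_mul hφt hnorm (norm_nonneg _) (hφs.2 t h0t).le
        _ = Q t * q := by simp only [Q]; ring
        _ ≤ q * q := mul_le_mul_of_nonneg_right hQq hq0
        _ = B := Real.mul_self_sqrt hB0
    · rintro ⟨B, hB⟩ ⟨L, hL0, hL⟩
      -- Under the uniform bounds the running suprema of `φ`, `1 / μ` and `β` are at most `B`, `L`
      -- and `L`.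
      refine ⟨max ((B * L) ^ 2) (max (P (a₂ (L ^ 2))) (P R)), fun t ht => ?_⟩
      have iSup_le : ∀ {f : ℝ → ℝ} {K s : ℝ}, (∀ t, 0 ≤ t → f t ≤ K) → 0 ≤ s →
          ⨆ τ : Icc (0 : ℝ) s, f τ ≤ K := fun hf hs =>
        have : Nonempty (Icc (0 : ℝ) _) := ⟨⟨0, le_rfl, hs⟩⟩
        ciSup_le fun τ => hf τ τ.2.1
      have hbL : b t ≤ L := iSup_le (fun s hs => by linarith [hL s hs, hinv.2 s hs])
        (add_nonneg ht S.r.2)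
      have hQBL : Q (2 * t) ≤ B * L := by
        have h2t : 0 ≤ 2 * t := by linarith
        have hμL : ⨆ τ : Icc (0 : ℝ) (2 * t + S.r), 1 / μ τ ≤ L :=
          iSup_le (f := fun s => 1 / μ s) (fun s hs => by linarith [hL s hs, hβ.2 s hs])
            (add_nonneg h2t S.r.2)
        exact mul_le_mul (iSup_le hB (by linarith)) hμL (hμs.2 _ h2t).le ((hφ.2 0 le_rfl).le.trans (hB 0 le_rfl))
      refine max_le_max (pow_le_pow_left₀ (hQ.2 _ (by linarith)).le hQBL 2)
        (max_le_max (hP_mono _ _ (ha₂.1.nonneg (sq_nonneg _)) (ha₂.1.mono (sq_nonneg _)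
          (pow_le_pow_left₀ (hβs.2 t ht).le hbL 2))) le_rfl)
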